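/- For a group $X$ let $\hat X=\varprojlim X/N$ ($N$ ranging over the normal subgroups of finite index) be its profinite completion. For a finitely generated group $\Gamma$ and a subgroup $G\le \mathrm{Aut}(\Gamma)$, the action of $G$ on $\Gamma$ extends uniquely to a continuous action of $\hat G$ on $\hat\Gamma$ by continuous automorphisms; the resulting homomorphism $\hat G\to \mathrm{Aut}(\hat\Gamma)$ is the congruence map, and its kernel $C(G,\Gamma)=\ker(\hat G\to \mathrm{Aut}(\hat\Gamma))$, with the topology of a subgroup of $\hat G$, is the congruence kernel. Write $C(\Gamma)=C(\mathrm{Aut}(\Gamma),\Gamma)$. Let $\bar\Gamma=\Gamma/[\Gamma,\Gamma]$, let $\Gamma^*=\bar\Gamma/\mathrm{tor}(\bar\Gamma)$ (so $\Gamma^*\cong\mathbb Z^d$ for some $d\ge 0$), and let $\mathrm{Aut}^*(\Gamma)\le \mathrm{Aut}(\Gamma^*)\cong GL_d(\mathbb Z)$ be the image of the natural homomorphism $\mathrm{Aut}(\Gamma)\to \mathrm{Aut}(\Gamma^*)$. The homomorphism $\widehat{\mathrm{Aut}(\Gamma)}\to\widehat{\mathrm{Aut}^*(\Gamma)}$ induced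 by $\mathrm{Aut}(\Gamma)\to \mathrm{Aut}^*(\Gamma)$ restricts to a continuous homomorphism $C(\Gamma)\to C(\mathrm{Aut}^*(\Gamma),\Gamma^*)$, called the canonical map. Theorem. Let $\Gamma$ be a finitely generated nilpotent group. Then the canonical map $C(\Gamma)\to C(\mathrm{Aut}^*(\Gamma),\Gamma^*)$ is an isomorphism of topological groups. -/

import Mathlib

open CategoryTheory

universe u

namespace CSP

noncomputable section

/-- The profinite completion of a group `G`: the limit of the `G ⧸ N` over all normal subgroups `N`
of finite index, with its topology. -/
abbrev Completion (G : Type u) [Group G] : ProfiniteGrp.{u} :=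
  ProfiniteGrp.profiniteCompletion.obj (GrpCat.of G)

section Completion

variable {G H : Type u} [Group G] [Group H]

/-- The canonical homomorphism from `G` to its profinite completion. -/
def eta (G : Type u) [Group G] : G →* Completion G :=
  (ProfiniteGrp.ProfiniteCompletion.eta (GrpCat.of G)).hom

/-- The continuous homomorphism between profinite completions induced by a homomorphism. -/
def completionMap (f : G →* H) : Completion G →ₜ* Completion H :=
  (ProfiniteGrp.profiniteCompletion.map (GrpCat.ofHom f)).hom

/-- The canonical projection of the profinite completion of `G` onto a finite quotient `G ⧸ N`. -/
def coord (N : FiniteIndexNormalSubgroup G) : Completion G →* G ⧸ N.toSubgroup where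
  toFun x := x.val N
  map_one' := rfl
  map_mul' _ _ := rfl

theorem coord_ext {x y : Completion G} (h : ∀ N, coord N x = coord N y) : x = y :=
  Subtype.ext (funext h)

@[simp] theorem coord_eta (N : FiniteIndexNormalSubgroup G) (g : G) :
    coord N (eta G g) = (g : G ⧸ N.toSubgroup) := rfl

theorem coord_of_le {N M : FiniteIndexNormalSubgroup G} (h : N ≤ M) {x : Completion G} {g : G}
    (hg : coord N x = (g : G ⧸ N.toSubgroup)) : coord M x = (g : G ⧸ M.toSubgroup) := by
  have := x.property (homOfLE h)
  change QuotientGroup.map _ _ (MonoidHom.id G) h (coord N x) = coord M x at this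
  rw [← this, hg]; rfl

theorem isOpen_coord_fiber (N : FiniteIndexNormalSubgroup G) (s : Set (G ⧸ N.toSubgroup)) :
    IsOpen {x : Completion G | coord N x ∈ s} := by
  let : TopologicalSpace (G ⧸ N.toSubgroup) := ⊥
  have : DiscreteTopology (G ⧸ N.toSubgroup) := ⟨rfl⟩
  have : Continuous (fun x : Completion G => coord N x) :=
    (continuous_apply N).comp continuous_subtype_val
  exact (isOpen_discrete s).preimage this

theorem continuous_of_coord {X : Type*} [TopologicalSpace X] {f : X → Completion G}
    (h : ∀ (N : FiniteIndexNormalSubgroup G) (s : Set (G ⧸ N.toSubgroup)),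
      IsOpen {x | coord N (f x) ∈ s}) : Continuous f := by
  refine Continuous.subtype_mk (continuous_pi fun N => ?_) fun x => (f x).property
  exact ⟨fun s _ => h N s⟩

theorem denseRange_eta : DenseRange (eta G) := ProfiniteGrp.ProfiniteCompletion.denseRange _

@[simp] theorem completionMap_eta (f : G →* H) (g : G) :
    completionMap f (eta G g) = eta H (f g) := by
  have := ProfiniteGrp.ProfiniteCompletion.lift_eta
    (GrpCat.ofHom f ≫ ProfiniteGrp.ProfiniteCompletion.eta (GrpCat.of H))
  exact ConcreteCategory.congr_hom this g

theorem coord_completionMap (f : G →* H) (N : FiniteIndexNormalSubgroup H) (x : Completion G) :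
    coord N (completionMap f x) =
      QuotientGroup.map (N.comap f).toSubgroup N.toSubgroup f le_rfl (coord (N.comap f) x) := by
  let : TopologicalSpace (H ⧸ N.toSubgroup) := ⊥
  have : DiscreteTopology (H ⧸ N.toSubgroup) := ⟨rfl⟩
  have h1 : Continuous fun x : Completion G => coord N (completionMap f x) :=
    ⟨fun s _ => (isOpen_coord_fiber N s).preimage (completionMap f).continuous_toFun⟩
  have h2 : Continuous fun x : Completion G =>
      QuotientGroup.map (N.comap f).toSubgroup N.toSubgroup f le_rfl (coord (N.comap f) x) :=
    ⟨fun s _ => isOpen_coord_fiber (N.comap f) (_ ⁻¹' s)⟩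
  refine congrFun (denseRange_eta.equalizer h1 h2 ?_) x
  funext g
  change coord N (completionMap f (eta G g)) = _
  rw [completionMap_eta]
  rfl

end Completion

section CharacteristicQuotients

variable {Γ : Type u} [Group Γ]

/-- The natural homomorphism `Aut(Γ) → Aut(Γ ⧸ M)` for a characteristic subgroup `M`. -/
def quotientAut (M : Subgroup Γ) [M.Normal] [hM : M.Characteristic] :
    MulAut Γ →* MulAut (Γ ⧸ M) where
  toFun φ := QuotientGroup.congr M M φ (Subgroup.characteristic_iff_map_eq.mp hM φ)
  map_one' := by ext x; induction x using QuotientGroup.induction_on; rfl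
  map_mul' φ ψ := by ext x; induction x using QuotientGroup.induction_on; rfl

@[simp] theorem quotientAut_mk (M : Subgroup Γ) [M.Normal] [M.Characteristic]
    (φ : MulAut Γ) (x : Γ) : quotientAut M φ (x : Γ ⧸ M) = (φ x : Γ) := rfl

/-- The principal congruence subgroup `G(M) = ker(G → Aut(Γ ⧸ M))` of `G ≤ Aut(Γ)`, for a
characteristic subgroup `M` of finite index in `Γ`. -/
def principalCongruenceSubgroup (G : Subgroup (MulAut Γ)) (M : FiniteIndexNormalSubgroup Γ)
    [M.toSubgroup.Characteristic] : FiniteIndexNormalSubgroup G where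
  toSubgroup := ((quotientAut M.toSubgroup).comp G.subtype).ker
  isFiniteIndex' := by
    have : Finite (MulAut (Γ ⧸ M.toSubgroup)) :=
      Finite.of_injective (fun e => (e : Γ ⧸ M.toSubgroup → Γ ⧸ M.toSubgroup)) DFunLike.coe_injective
    infer_instance

/-- In a finitely generated group, the intersection of the images of a normal subgroup of finite
index under all automorphisms is a characteristic subgroup of finite index. -/
def charCore [Group.FG Γ] (N : FiniteIndexNormalSubgroup Γ) : FiniteIndexNormalSubgroup Γ where
  toSubgroup := ⨅ φ : MulAut Γ, N.toSubgroup.comap φ.toMonoidHom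
  isNormal' := Subgroup.normal_iInf_normal fun _ => inferInstance
  isFiniteIndex' := by
    let Q := Γ ⧸ N.toSubgroup
    let F : MulAut Γ → (Γ →* Q) := fun φ => (QuotientGroup.mk' N.toSubgroup).comp φ.toMonoidHom
    have : Finite (Γ →* Q) := by
      obtain ⟨S, hS, hfin⟩ := Group.fg_iff.mp ‹Group.FG Γ›
      have := hfin.to_subtype
      refine Finite.of_injective (fun (f : Γ →* Q) (s : S) => f s) fun f g h => ?_
      exact MonoidHom.eq_of_eqOn_dense hS fun s hs => congrFun h ⟨s, hs⟩
    have : (⨅ φ : MulAut Γ, N.toSubgroup.comap φ.toMonoidHom) =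
        ⨅ f : Set.range F, (f : Γ →* Q).ker := by
      ext x
      simp only [Subgroup.mem_iInf, Set.forall_subtype_range_iff, MonoidHom.mem_ker]
      exact forall_congr' fun φ => (QuotientGroup.eq_one_iff (φ x)).symm
    rw [this]
    exact Subgroup.finiteIndex_iInf fun f => inferInstance

variable [Group.FG Γ]

theorem mem_charCore {N : FiniteIndexNormalSubgroup Γ} {x : Γ} :
    x ∈ (charCore N).toSubgroup ↔ ∀ φ : MulAut Γ, φ x ∈ N.toSubgroup := by
  simp [charCore, Subgroup.mem_iInf]

instance charCore_characteristic (N : FiniteIndexNormalSubgroup Γ) :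
    (charCore N).toSubgroup.Characteristic :=
  Subgroup.characteristic_iff_le_comap.mpr fun φ _ hx =>
    mem_charCore.mpr fun ψ => mem_charCore.mp hx (ψ * φ)

theorem charCore_le (N : FiniteIndexNormalSubgroup Γ) : charCore N ≤ N :=
  fun _ hx => mem_charCore.mp hx 1

theorem charCore_mono {N M : FiniteIndexNormalSubgroup Γ} (h : N ≤ M) :
    charCore N ≤ charCore M :=
  fun _ hx => mem_charCore.mpr fun φ => h (mem_charCore.mp hx φ)

end CharacteristicQuotients

section CongruenceMap

variable {Γ : Type u} [Group Γ]

theorem principalCongruenceSubgroup_mono (G : Subgroup (MulAut Γ))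
    {M M' : FiniteIndexNormalSubgroup Γ} [M.toSubgroup.Characteristic]
    [M'.toSubgroup.Characteristic] (h : M ≤ M') :
    principalCongruenceSubgroup G M ≤ principalCongruenceSubgroup G M' := by
  intro g hg
  change quotientAut M.toSubgroup (g : MulAut Γ) = 1 at hg
  change quotientAut M'.toSubgroup (g : MulAut Γ) = 1
  ext x
  induction x using QuotientGroup.induction_on with | H x => ?_
  have := DFunLike.congr_fun hg (x : Γ ⧸ M.toSubgroup)
  rw [quotientAut_mk] at this
  rw [quotientAut_mk]
  exact QuotientGroup.eq.mpr (h (QuotientGroup.eq.mp this))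

variable [Group.FG Γ] (G : Subgroup (MulAut Γ))

/-- For `M` the characteristic core of `N`: an element `a` of `Ĝ` acts on `Γ ⧸ M` through
`Ĝ → G ⧸ G(M) → Aut(Γ ⧸ M)`. Apply this to the image of `x` in `Γ ⧸ M` and project to `Γ ⧸ N`. -/
def actCoord (N : FiniteIndexNormalSubgroup Γ) (a : Completion G) (x : Completion Γ) :
    Γ ⧸ N.toSubgroup :=
  QuotientGroup.map (charCore N).toSubgroup N.toSubgroup (MonoidHom.id Γ) (charCore_le N)
    (QuotientGroup.kerLift ((quotientAut (charCore N).toSubgroup).comp G.subtype)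
      (coord (principalCongruenceSubgroup G (charCore N)) a) (coord (charCore N) x))

variable {G}

theorem actCoord_eq {N : FiniteIndexNormalSubgroup Γ} {a : Completion G} {x : Completion Γ}
    {g : G} {γ : Γ}
    (hg : coord (principalCongruenceSubgroup G (charCore N)) a = (g : G ⧸ _))
    (hγ : coord (charCore N) x = (γ : Γ ⧸ _)) :
    actCoord G N a x = ((g : MulAut Γ) γ : Γ) := by
  rw [actCoord, hg, hγ]; rfl

/-- The action of an element of `Ĝ` on the profinite completion of `Γ`. -/
def act (a : Completion G) (x : Completion Γ) : Completion Γ :=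
  ⟨fun N => actCoord G N a x, by
    intro N N' π
    have h := π.le
    obtain ⟨g, hg⟩ := QuotientGroup.mk_surjective
      (coord (principalCongruenceSubgroup G (charCore N)) a)
    obtain ⟨γ, hγ⟩ := QuotientGroup.mk_surjective (coord (charCore N) x)
    change QuotientGroup.map _ _ (MonoidHom.id Γ) h (actCoord G N a x) = actCoord G N' a x
    rw [actCoord_eq hg.symm hγ.symm, actCoord_eq
      (coord_of_le (principalCongruenceSubgroup_mono G (charCore_mono h)) hg.symm)
      (coord_of_le (charCore_mono h) hγ.symm)]
    rfl⟩

theorem coord_act {N : FiniteIndexNormalSubgroup Γ} {a : Completion G} {x : Completion Γ}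
    {g : G} {γ : Γ}
    (hg : coord (principalCongruenceSubgroup G (charCore N)) a = (g : G ⧸ _))
    (hγ : coord (charCore N) x = (γ : Γ ⧸ _)) :
    coord N (act a x) = ((g : MulAut Γ) γ : Γ) := actCoord_eq hg hγ

theorem act_one (x : Completion Γ) : act (1 : Completion G) x = x := by
  refine coord_ext fun N => ?_
  obtain ⟨γ, hγ⟩ := QuotientGroup.mk_surjective (coord (charCore N) x)
  rw [coord_act (g := 1) (map_one _) hγ.symm, coord_of_le (charCore_le N) hγ.symm]
  rfl

theorem act_mul (a b : Completion G) (x : Completion Γ) : act (a * b) x = act a (act b x) := by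
  refine coord_ext fun N => ?_
  have hN := charCore_le (charCore N)
  obtain ⟨g, hg⟩ := QuotientGroup.mk_surjective
    (coord (principalCongruenceSubgroup G (charCore N)) a)
  obtain ⟨h, hh⟩ := QuotientGroup.mk_surjective
    (coord (principalCongruenceSubgroup G (charCore (charCore N))) b)
  obtain ⟨γ, hγ⟩ := QuotientGroup.mk_surjective (coord (charCore (charCore N)) x)
  have hh' := coord_of_le (principalCongruenceSubgroup_mono G hN) hh.symm
  rw [coord_act hg.symm (coord_act hh.symm hγ.symm),
    coord_act (g := g * h) (by rw [map_mul, ← hg, hh']; rfl) (coord_of_le hN hγ.symm)]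
  rfl

theorem act_map_mul (a : Completion G) (x y : Completion Γ) :
    act a (x * y) = act a x * act a y := by
  refine coord_ext fun N => ?_
  obtain ⟨g, hg⟩ := QuotientGroup.mk_surjective
    (coord (principalCongruenceSubgroup G (charCore N)) a)
  obtain ⟨γ, hγ⟩ := QuotientGroup.mk_surjective (coord (charCore N) x)
  obtain ⟨δ, hδ⟩ := QuotientGroup.mk_surjective (coord (charCore N) y)
  rw [map_mul, coord_act hg.symm hγ.symm, coord_act hg.symm hδ.symm,
    coord_act (γ := γ * δ) hg.symm (by rw [map_mul, ← hγ, ← hδ]; rfl), map_mul]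
  rfl

/-- The action is jointly continuous. -/
theorem continuous_act :
    Continuous fun p : Completion G × Completion Γ => act p.1 p.2 := by
  refine continuous_of_coord fun N s => isOpen_iff_forall_mem_open.mpr fun p hp => ?_
  refine ⟨{a | coord (principalCongruenceSubgroup G (charCore N)) a ∈
      ({coord (principalCongruenceSubgroup G (charCore N)) p.1} : Set _)} ×ˢ
    {x | coord (charCore N) x ∈ ({coord (charCore N) p.2} : Set _)}, ?_,
    (isOpen_coord_fiber _ _).prod (isOpen_coord_fiber _ _), rfl, rfl⟩
  rintro ⟨a, x⟩ ⟨ha, hx⟩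
  have ha' : coord (principalCongruenceSubgroup G (charCore N)) a =
    coord (principalCongruenceSubgroup G (charCore N)) p.1 := ha
  have hx' : coord (charCore N) x = coord (charCore N) p.2 := hx
  change actCoord G N a x ∈ s
  rw [actCoord, ha', hx']
  exact hp

/-- `Aut(P)` for a topological group `P`: the group of its continuous automorphisms (with
continuous inverse). -/
def contAut (P : Type*) [Group P] [TopologicalSpace P] : Subgroup (MulAut P) where
  carrier := {e | Continuous e ∧ Continuous e.symm}
  one_mem' := ⟨continuous_id, continuous_id⟩
  mul_mem' h k := ⟨h.1.comp k.1, k.2.comp h.2⟩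
  inv_mem' h := ⟨h.2, h.1⟩

theorem continuous_act_right (a : Completion G) : Continuous (act (Γ := Γ) a) :=
  continuous_act.comp (continuous_const.prodMk continuous_id)

/-- The congruence map `Ĝ → Aut(Γ̂)`. -/
def congruenceMap (G : Subgroup (MulAut Γ)) : Completion G →* contAut (Completion Γ) where
  toFun a := ⟨{ toFun := act a
                invFun := act a⁻¹
                left_inv := fun x => by rw [← act_mul, inv_mul_cancel, act_one]
                right_inv := fun x => by rw [← act_mul, mul_inv_cancel, act_one]
                map_mul' := act_map_mul a }, continuous_act_right a, continuous_act_right a⁻¹⟩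
  map_one' := Subtype.ext (MulEquiv.ext act_one)
  map_mul' a b := Subtype.ext (MulEquiv.ext (act_mul a b))

/-- The congruence map extends the action of `G` on `Γ`. Together with `continuous_act` this
determines it. -/
theorem congruenceMap_eta (g : G) (γ : Γ) :
    (congruenceMap G (eta G g) : MulAut (Completion Γ)) (eta Γ γ) =
      eta Γ ((g : MulAut Γ) γ) :=
  coord_ext fun _ => rfl

/-- The congruence kernel `C(G, Γ) = ker(Ĝ → Aut(Γ̂))`, a topological group as a subgroup
of `Ĝ`. -/
def congruenceKernel (G : Subgroup (MulAut Γ)) : Subgroup (Completion G) :=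
  (congruenceMap G).ker

theorem mem_congruenceKernel {a : Completion G} :
    a ∈ congruenceKernel G ↔ ∀ x : Completion Γ, act a x = x := by
  rw [congruenceKernel, MonoidHom.mem_ker, Subtype.ext_iff, MulEquiv.ext_iff]
  rfl

end CongruenceMap

section Star

variable (Γ : Type u) [Group Γ]

/-- `Γ* = Γ̄ ⧸ tor(Γ̄)`, the abelianization `Γ̄` of `Γ` modulo its torsion subgroup. -/
abbrev Star : Type u := Abelianization Γ ⧸ CommGroup.torsion (Abelianization Γ)

instance star_fg [Group.FG Γ] : Group.FG (Star Γ) :=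
  Group.fg_of_surjective (f := (QuotientGroup.mk' (CommGroup.torsion (Abelianization Γ))).comp
    Abelianization.of)
    ((QuotientGroup.mk'_surjective _).comp (QuotientGroup.mk'_surjective _))

/-- The projection `Γ → Γ*`. -/
def toStar : Γ →* Star Γ :=
  (QuotientGroup.mk' (CommGroup.torsion (Abelianization Γ))).comp Abelianization.of

theorem toStar_surjective : Function.Surjective (toStar Γ) :=
  (QuotientGroup.mk'_surjective _).comp (QuotientGroup.mk'_surjective _)

instance torsion_characteristic (A : Type u) [CommGroup A] :
    (CommGroup.torsion A).Characteristic :=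
  Subgroup.characteristic_iff_le_comap.mpr fun φ =>
    CommGroup.le_comap_torsion φ.toMonoidHom

/-- The natural homomorphism `Aut(Γ) → Aut(Γ*)`. -/
def starAut : MulAut Γ →* MulAut (Star Γ) :=
  (quotientAut (CommGroup.torsion (Abelianization Γ))).comp (quotientAut (commutator Γ))

@[simp] theorem starAut_toStar (φ : MulAut Γ) (γ : Γ) :
    starAut Γ φ (toStar Γ γ) = toStar Γ (φ γ) := rfl

/-- `Aut*(Γ)`, the image of `Aut(Γ) → Aut(Γ*)`. -/
def AutStar : Subgroup (MulAut (Star Γ)) := (starAut Γ).range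

/-- The canonical epimorphism `Aut(Γ) → Aut*(Γ)`, where `Aut(Γ)` is regarded as a subgroup of
itself. -/
def toAutStar : (⊤ : Subgroup (MulAut Γ)) →* AutStar Γ :=
  (starAut Γ).rangeRestrict.comp (⊤ : Subgroup (MulAut Γ)).subtype

theorem completionMap_mem_congruenceKernel [Group.FG Γ]
    {a : Completion (⊤ : Subgroup (MulAut Γ))} (ha : a ∈ congruenceKernel ⊤) :
    completionMap (toAutStar Γ) a ∈ congruenceKernel (AutStar Γ) := by
  rw [mem_congruenceKernel] at ha ⊢
  intro y
  refine coord_ext fun N => ?_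
  let K := (principalCongruenceSubgroup (AutStar Γ) (charCore N)).comap (toAutStar Γ)
  let N' := N.comap (toStar Γ)
  let K' := principalCongruenceSubgroup (⊤ : Subgroup (MulAut Γ)) (charCore N')
  obtain ⟨g, hg⟩ := QuotientGroup.mk_surjective (coord (K ⊓ K') a)
  have h1 : coord K a = (g : _ ⧸ K.toSubgroup) := coord_of_le inf_le_left hg.symm
  have h2 : coord K' a = (g : _ ⧸ K'.toSubgroup) := coord_of_le inf_le_right hg.symm
  obtain ⟨z, hz⟩ := QuotientGroup.mk_surjective (coord (charCore N) y)
  obtain ⟨γ, rfl⟩ := toStar_surjective Γ z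
  rw [coord_act (g := toAutStar Γ g) (by rw [coord_completionMap]; erw [h1]; rfl) hz.symm,
    coord_of_le (charCore_le N) hz.symm]
  have h3 := congrArg (coord N') (ha (eta Γ γ))
  rw [coord_act (γ := γ) h2 rfl] at h3
  change ((((g : MulAut Γ) γ : Γ) : Γ ⧸ N'.toSubgroup)) = (γ : Γ ⧸ N'.toSubgroup) at h3
  have h4 := QuotientGroup.eq.mp h3
  refine QuotientGroup.eq.mpr ?_
  change ((starAut Γ g) (toStar Γ γ))⁻¹ * toStar Γ γ ∈ N.toSubgroup
  rw [starAut_toStar, ← map_inv, ← map_mul]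
  exact h4

/-- The canonical map `C(Γ) → C(Aut*(Γ), Γ*)`, where `C(Γ) = C(Aut(Γ), Γ)`: the restriction of the
homomorphism of profinite completions induced by `Aut(Γ) → Aut*(Γ)`. -/
def canonicalMap [Group.FG Γ] :
    congruenceKernel (⊤ : Subgroup (MulAut Γ)) →ₜ* congruenceKernel (AutStar Γ) where
  toFun a := ⟨completionMap (toAutStar Γ) a.1, completionMap_mem_congruenceKernel Γ a.2⟩
  map_one' := Subtype.ext (map_one _)
  map_mul' _ _ := Subtype.ext (map_mul _ _ _)
  continuous_toFun := Continuous.subtype_mk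
    ((completionMap (toAutStar Γ)).continuous_toFun.comp continuous_subtype_val) _

end Star

end

end CSP

namespace CSP

/-! ### Finite generation of groups assembled from abelian pieces -/

section FinitelyGenerated

/-! Let V be the module of integer-valued polynomial functions on Γ of degree less than n. It is
finitely generated over ℤ; Γ acts on it by right translations and Aut(Γ) by substitution, the second
action normalizing the first (`autRep_conj`). Translations are unipotent for the degree filtration.
The action of an automorphism on the graded pieces is controlled by Γ*: automorphisms trivial on Γ*
act unipotently, and automorphisms close to 1 on Γ* act by something close to a unipotent element.
For large n the translation action is faithful on a subgroup of finite index
(`exists_polySeparated`). The question thus moves to unipotent groups over ℤ, where subgroups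
containing e-th powers are controlled by congruences (`NilFiltration.approx_ker`).

Injectivity rests on `exists_congruence_le`: on the kernel of Aut(Γ) → Aut(Γ*), every subgroup of
finite index of Aut(Γ) contains all automorphisms that are trivial on a suitable finite quotient of
Γ.

Surjectivity rests on `exists_aut_of_starCongr`: an automorphism φ close to 1 on Γ* can be replaced
by one close to 1 on Γ with the same action on Γ*. Indeed φ is close to a unipotent k. Since k is
close to an element normalizing the image Λ of Γ, it is close to a unipotent κ normalizing Λ
(`NilFiltration.exists_mem_normalizer`). Conjugation by κ⁻¹φ preserves Λ and, being close to the
identity, lifts to an automorphism of Γ; the factor κ is invisible on Γ*. Compactness of the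
completion turns these approximations into an actual preimage, and makes the continuous bijection a
homeomorphism. -/

theorem fg_of_injective_commGroup {G W : Type*} [Group G] [CommGroup W] [Group.FG W] (f : G →* W)
    (hf : Function.Injective f) : Group.FG G := by
  have hM : Module.Finite ℤ (Additive W) :=
    Module.Finite.iff_addGroup_fg.mpr (AddGroup.fg_iff_mul_fg.mpr ‹Group.FG W›)
  have h1 : (AddSubgroup.toIntSubmodule (Subgroup.toAddSubgroup f.range)).FG :=
    IsNoetherian.noetherian _
  have h2 : f.range.FG := by
    rw [Subgroup.fg_iff_add_fg]
    rw [Submodule.fg_iff_addSubgroup_fg] at h1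
    exact h1
  have h3 : Group.FG f.range := (Group.fg_iff_subgroup_fg _).mpr h2
  exact Group.fg_of_surjective (f := (MonoidHom.ofInjective hf).symm.toMonoidHom)
    (MonoidHom.ofInjective hf).symm.surjective

theorem fg_subgroup_commGroup {W : Type*} [CommGroup W] [Group.FG W] (H : Subgroup W) :
    Group.FG H :=
  fg_of_injective_commGroup H.subtype H.subtype_injective

/-- An extension of a finitely generated group by a finitely generated group is finitely
generated. -/
theorem fg_of_ker_range {G W : Type*} [Group G] [Group W] (f : G →* W) [hr : Group.FG f.range]
    [hk : Group.FG f.ker] : Group.FG G := by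
  obtain ⟨S, hS, hSf⟩ := Group.fg_iff.mp hr
  obtain ⟨T, hT, hTf⟩ := Group.fg_iff.mp hk
  choose s hs using fun w : f.range => w.2
  refine Group.fg_iff.mpr ⟨s '' S ∪ f.ker.subtype '' T, ?_, (hSf.image _).union (hTf.image _)⟩
  set H := Subgroup.closure (s '' S ∪ f.ker.subtype '' T)
  have hker : f.ker ≤ H := by
    have : f.ker = (Subgroup.closure T).map f.ker.subtype := by
      rw [hT, ← MonoidHom.range_eq_map, Subgroup.range_subtype]
    rw [this, MonoidHom.map_closure]
    exact Subgroup.closure_mono Set.subset_union_right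
  have hran : f.range ≤ H.map f := by
    have : f.range = (Subgroup.closure S).map f.range.subtype := by
      rw [hS, ← MonoidHom.range_eq_map, Subgroup.range_subtype]
    rw [this, MonoidHom.map_closure, Subgroup.closure_le]
    rintro _ ⟨w, hw, rfl⟩
    exact ⟨s w, Subgroup.subset_closure (Or.inl ⟨w, hw, rfl⟩), hs w⟩
  rw [eq_top_iff]
  intro g _
  obtain ⟨h, hh, he⟩ := hran ⟨g, rfl⟩
  have h1 : h⁻¹ * g ∈ f.ker := by rw [MonoidHom.mem_ker, map_mul, map_inv, he, inv_mul_cancel]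
  have := H.mul_mem hh (hker h1)
  rwa [mul_inv_cancel_left] at this

theorem fg_of_ker_commGroup {G W : Type*} [Group G] [CommGroup W] [Group.FG W] (f : G →* W)
    (hk : Group.FG f.ker) : Group.FG G :=
  have := fg_subgroup_commGroup f.range
  fg_of_ker_range f

/-- If `f` kills the kernel of a homomorphism to a finitely generated abelian group, then the
image of `f` is finitely generated. -/
theorem fg_of_surjective_of_ker_le {G W V : Type*} [Group G] [Group W] [CommGroup V] [Group.FG V]
    (f : G →* W) (hf : Function.Surjective f) (g : G →* V) (h : g.ker ≤ f.ker) : Group.FG W := by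
  have := fg_of_injective_commGroup (QuotientGroup.kerLift g) (QuotientGroup.kerLift_injective g)
  exact Group.fg_of_surjective (f := QuotientGroup.lift g.ker f h)
    (QuotientGroup.lift_surjective_of_surjective _ _ hf h)

end FinitelyGenerated

/-! ### Artin–Rees and approximation of deep elements -/

section Approximation

/-- An Artin–Rees property for subgroups of finitely generated abelian groups. -/
theorem exists_nsmul_mem {W : Type*} [AddCommGroup W] [Module.Finite ℤ W] (H : Submodule ℤ W)
    {e : ℕ} (he : 0 < e) :
    ∃ m > 0, ∀ v : W, m • v ∈ H → ∃ h ∈ H, m • v = e • h := by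
  have : Module.IsTorsion ℤ (Submodule.torsion ℤ (W ⧸ H)) := Submodule.torsion_isTorsion
  have hfin := Module.finite_of_fg_torsion _ this
  -- If a positive multiple of `v` lies in `H`, then `v` is torsion modulo `H`, so the order of the
  -- torsion subgroup already moves `v` into `H`; the factor `e` is then left over.
  refine ⟨e * Nat.card (Submodule.torsion ℤ (W ⧸ H)), Nat.mul_pos he Nat.card_pos, fun v hv => ?_⟩
  refine ⟨Nat.card (Submodule.torsion ℤ (W ⧸ H)) • v, ?_, mul_nsmul' v e _⟩
  have hm : e * Nat.card (Submodule.torsion ℤ (W ⧸ H)) ≠ 0 :=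
    (Nat.mul_pos he Nat.card_pos).ne'
  have ht : (Submodule.Quotient.mk v : W ⧸ H) ∈ Submodule.torsion ℤ (W ⧸ H) := by
    rw [Submodule.mem_torsion_iff]
    refine ⟨⟨_, mem_nonZeroDivisors_of_ne_zero (Int.natCast_ne_zero.mpr hm)⟩, ?_⟩
    change ((e * Nat.card (Submodule.torsion ℤ (W ⧸ H)) : ℕ) : ℤ) •
      (Submodule.Quotient.mk v : W ⧸ H) = 0
    rw [natCast_zsmul, ← Submodule.Quotient.mk_smul, Submodule.Quotient.mk_eq_zero]
    exact hv
  have := card_nsmul_eq_zero' (x := (⟨_, ht⟩ : Submodule.torsion ℤ (W ⧸ H)))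
  have := congrArg Subtype.val this
  rw [← Submodule.Quotient.mk_eq_zero H, Submodule.Quotient.mk_smul]
  exact this

theorem exists_pow_eq_of_pow_mem_range {K W : Type*} [Group K] [CommGroup W] [Group.FG W]
    (h : K →* W) {e : ℕ} (he : 0 < e) :
    ∃ m > 0, ∀ (k : K) (w : W), h k = w ^ m → ∃ k' : K, h k = h (k' ^ e) := by
  have hM : Module.Finite ℤ (Additive W) :=
    Module.Finite.iff_addGroup_fg.mpr (AddGroup.fg_iff_mul_fg.mpr ‹Group.FG W›)
  obtain ⟨m, hm, H⟩ := exists_nsmul_mem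
    (AddSubgroup.toIntSubmodule (Subgroup.toAddSubgroup h.range)) he
  refine ⟨m, hm, fun k w hkw => ?_⟩
  obtain ⟨_, ⟨k', rfl⟩, hk'⟩ := H (Additive.ofMul w) ⟨k, hkw⟩
  refine ⟨k', ?_⟩
  rw [hkw, map_pow]
  exact hk'

variable {G : Type*} [Group G]

/-- Elements of `A` in deep `S m` lie in `N * B`, for each `N` containing all `e`-th powers of
elements of `A`, some `e > 0`. -/
def Approx (S : ℕ → Subgroup G) (A B : Subgroup G) : Prop :=
  ∀ N : Subgroup G, (∃ e > 0, ∀ g ∈ A, g ^ e ∈ N) →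
    ∃ m > 0, ∀ g ∈ A, g ∈ S m → ∃ n ∈ N, n⁻¹ * g ∈ B

theorem Approx.refl (S : ℕ → Subgroup G) (A : Subgroup G) : Approx S A A :=
  fun N _ => ⟨1, one_pos, fun g hg _ => ⟨1, N.one_mem, by simpa using hg⟩⟩

theorem Approx.mono {S : ℕ → Subgroup G} {A B C : Subgroup G} (h : Approx S A B) (hBC : B ≤ C) :
    Approx S A C := fun N hN =>
  let ⟨m, hm, H⟩ := h N hN
  ⟨m, hm, fun g hg hs => let ⟨n, hn, hb⟩ := H g hg hs; ⟨n, hn, hBC hb⟩⟩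

/-- Applying the first approximation to `N ⊓ S m` instead of `N` keeps the correcting element in `S
m`, so the corrected element is still deep enough for the second approximation. -/
theorem Approx.trans {S : ℕ → Subgroup G} {A B C : Subgroup G}
    (hS : ∀ a b, a ∣ b → S b ≤ S a) (hpow : ∀ m > 0, ∃ e > 0, ∀ g, g ^ e ∈ S m)
    (h1 : Approx S A B) (hBA : B ≤ A) (h2 : Approx S B C) : Approx S A C := by
  rintro N ⟨e, he, hN⟩
  obtain ⟨m, hm, H2⟩ := h2 N ⟨e, he, fun g hg => hN g (hBA hg)⟩
  obtain ⟨e', he', hS'⟩ := hpow m hm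
  obtain ⟨m', hm', H1⟩ := h1 (N ⊓ S m) ⟨e * e', Nat.mul_pos he he', fun g hg =>
    ⟨by rw [pow_mul]; exact N.pow_mem (hN g hg) _, by
      rw [pow_mul']; exact (S m).pow_mem (hS' g) _⟩⟩
  refine ⟨m * m', Nat.mul_pos hm hm', fun g hg hgS => ?_⟩
  obtain ⟨n, hn, hb⟩ := H1 g hg (hS _ _ (dvd_mul_left _ _) hgS)
  obtain ⟨n', hn', hc⟩ := H2 _ hb
    ((S m).mul_mem ((S m).inv_mem hn.2) (hS _ _ (dvd_mul_right _ _) hgS))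
  exact ⟨n * n', N.mul_mem hn.1 hn', by rwa [mul_inv_rev, mul_assoc]⟩

/-- The image of a deep element is a high power in `W`, hence by Artin–Rees the image of some `k ^
e`. Since `k ^ e` lies in `N`, dividing by it leaves an element of the kernel of `h`. -/
theorem Approx.of_hom {S : ℕ → Subgroup G} {A B : Subgroup G} {W : Type*} [CommGroup W]
    [Group.FG W] (h : A →* W)
    (hS : ∀ m > 0, ∃ m' > 0, ∀ a : A, (a : G) ∈ S m' → ∃ w, h a = w ^ m)
    (hB : ∀ a : A, h a = 1 → (a : G) ∈ B) : Approx S A B := by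
  rintro N ⟨e, he, hN⟩
  obtain ⟨m, hm, H⟩ := exists_pow_eq_of_pow_mem_range h he
  obtain ⟨m', hm', H'⟩ := hS m hm
  refine ⟨m', hm', fun g hg hgS => ?_⟩
  obtain ⟨w, hw⟩ := H' ⟨g, hg⟩ hgS
  obtain ⟨k, hk⟩ := H _ w hw
  refine ⟨k ^ e, hN k k.2, ?_⟩
  refine hB ((k ^ e)⁻¹ * ⟨g, hg⟩) ?_
  rw [map_mul, map_inv, hk, inv_mul_cancel]

end Approximation

/-! ### Unipotent and congruence subgroups of the units of a filtered ring -/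

section NilpotentFiltration

/-- A finite decreasing multiplicative filtration of a ring by additive subgroups, starting with the
whole ring. -/
structure NilFiltration (R : Type*) [Ring R] where
  I : ℕ → AddSubgroup R
  anti : ∀ i, I (i + 1) ≤ I i
  zero : I 0 = ⊤
  len : ℕ
  bot : I len = ⊥
  mul : ∀ {i j : ℕ} {a b : R}, a ∈ I i → b ∈ I j → a * b ∈ I (i + j)

namespace NilFiltration

variable {R : Type*} [Ring R] (F : NilFiltration R)

theorem antitone : Antitone F.I := antitone_nat_of_succ_le F.anti

theorem mem_zero (a : R) : a ∈ F.I 0 := by rw [F.zero]; trivial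

theorem mul_left {i : ℕ} (a : R) {b : R} (hb : b ∈ F.I i) : a * b ∈ F.I i := by
  simpa using F.mul (F.mem_zero a) hb

theorem mul_right {i : ℕ} {a : R} (ha : a ∈ F.I i) (b : R) : a * b ∈ F.I i := by
  simpa using F.mul ha (F.mem_zero b)

/-- The units congruent to `1` modulo the `i`-th step of the filtration. -/
def U (i : ℕ) : Subgroup Rˣ where
  carrier := {u | (u : R) - 1 ∈ F.I i}
  one_mem' := by simp
  mul_mem' {a b} ha hb := by
    have : ((a * b : Rˣ) : R) - 1 = a * ((b : R) - 1) + ((a : R) - 1) := by push_cast; noncomm_ring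
    change ((a * b : Rˣ) : R) - 1 ∈ F.I i
    rw [this]
    exact add_mem (F.mul_left _ hb) ha
  inv_mem' {a} ha := by
    have : ((a⁻¹ : Rˣ) : R) - 1 = -(((a⁻¹ : Rˣ) : R) * ((a : R) - 1)) := by
      rw [mul_sub, Units.inv_mul, mul_one, neg_sub]
    change ((a⁻¹ : Rˣ) : R) - 1 ∈ F.I i
    rw [this]
    exact neg_mem (F.mul_left _ ha)

theorem mem_U {i : ℕ} {u : Rˣ} : u ∈ F.U i ↔ (u : R) - 1 ∈ F.I i := Iff.rfl

theorem U_antitone : Antitone F.U := fun _ _ h _ hu => F.antitone h hu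

theorem U_len : F.U F.len = ⊥ := by
  rw [eq_bot_iff]
  intro u hu
  rw [mem_U, F.bot, AddSubgroup.mem_bot, sub_eq_zero] at hu
  exact Units.ext hu

instance U_normal (i : ℕ) : (F.U i).Normal where
  conj_mem u hu g := by
    rw [mem_U] at hu ⊢
    have : ((g * u * g⁻¹ : Rˣ) : R) - 1 = g * ((u : R) - 1) * ((g⁻¹ : Rˣ) : R) := by
      push_cast; rw [mul_sub, sub_mul, mul_one, Units.mul_inv]
    rw [this]
    exact F.mul_right (F.mul_left _ hu) _

/-- uvu⁻¹v⁻¹ - 1 = (uv - vu)u⁻¹v⁻¹, and uv - vu is the additive commutator of u - 1 and v - 1. -/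
theorem commutator_mem {i : ℕ} {u v : Rˣ} (hu : u ∈ F.U 1) (hv : v ∈ F.U i) :
    u * v * u⁻¹ * v⁻¹ ∈ F.U (i + 1) := by
  rw [mem_U] at *
  have : ((u * v * u⁻¹ * v⁻¹ : Rˣ) : R) - 1 =
      (((u : R) - 1) * ((v : R) - 1) - ((v : R) - 1) * ((u : R) - 1)) *
        ((u⁻¹ * v⁻¹ : Rˣ) : R) := by
    have h : ((u : R) - 1) * ((v : R) - 1) - ((v : R) - 1) * ((u : R) - 1) =
      ((u * v : Rˣ) : R) - ((v * u : Rˣ) : R) := by push_cast; noncomm_ring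
    rw [h, sub_mul, ← Units.val_mul, ← Units.val_mul]
    congr 1
    · rw [mul_assoc (u * v)]
    · simp
  rw [this]
  refine F.mul_right (sub_mem ?_ ?_) _
  · rw [add_comm]; exact F.mul hu hv
  · exact F.mul hv hu

/-- The homomorphism `u ↦ u - 1` modulo the next step of the filtration. -/
def gr (i : ℕ) : F.U (i + 1) →* Multiplicative (R ⧸ F.I (i + 2)) where
  toFun u := Multiplicative.ofAdd (QuotientAddGroup.mk ((u : Rˣ) - 1 : R))
  map_one' := by simp
  map_mul' u v := by
    rw [← ofAdd_add, ← QuotientAddGroup.mk_add]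
    refine congrArg _ (QuotientAddGroup.eq.mpr ?_)
    have h1 : -(((u * v : F.U (i + 1)) : Rˣ) - 1 : R) + ((((u : Rˣ) : R) - 1) + (((v : Rˣ) : R) - 1))
      = - ((((u : Rˣ) : R) - 1) * (((v : Rˣ) : R) - 1)) := by push_cast; noncomm_ring
    rw [h1]
    -- The error (u - 1)(v - 1) lies in step 2(i + 1), which is at least i + 2; this is why the map
    -- starts at `U (i + 1)`.
    exact neg_mem (F.antitone (by omega) (F.mul u.2 v.2))

theorem gr_eq_one {i : ℕ} {u : F.U (i + 1)} : F.gr i u = 1 ↔ (u : Rˣ) ∈ F.U (i + 2) :=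
  (QuotientAddGroup.eq_zero_iff (N := F.I (i + 2)) ((u : Rˣ) - 1 : R))

end NilFiltration

/-- The principal congruence subgroup of level `m` in the units of a ring. -/
def congruenceUnits (R : Type*) [Ring R] (m : ℕ) : Subgroup Rˣ where
  carrier := {u | ∃ θ : R, (u : R) - 1 = m • θ}
  one_mem' := ⟨0, by simp⟩
  mul_mem' := by
    rintro a b ⟨θ, hθ⟩ ⟨η, hη⟩
    refine ⟨a * η + θ, ?_⟩
    rw [smul_add, ← mul_smul_comm, ← hθ, ← hη]
    push_cast; noncomm_ring
  inv_mem' := by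
    rintro a ⟨θ, hθ⟩
    refine ⟨-(((a⁻¹ : Rˣ) : R) * θ), ?_⟩
    rw [smul_neg, ← mul_smul_comm, ← hθ, mul_sub, Units.inv_mul, mul_one, neg_sub]

section CongruenceUnits

variable {R : Type*} [Ring R]

instance congruenceUnits_normal (m : ℕ) : (congruenceUnits R m).Normal where
  conj_mem := by
    rintro u ⟨θ, hθ⟩ g
    refine ⟨g * θ * ((g⁻¹ : Rˣ) : R), ?_⟩
    rw [← smul_mul_assoc, ← mul_smul_comm, ← hθ]
    push_cast; rw [mul_sub, sub_mul, mul_one, Units.mul_inv]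

theorem congruenceUnits_anti {a b : ℕ} (h : a ∣ b) : congruenceUnits R b ≤ congruenceUnits R a := by
  rintro u ⟨θ, hθ⟩
  obtain ⟨c, rfl⟩ := h
  exact ⟨c • θ, by rw [hθ, mul_smul]⟩

/-- Units with the same class in the finite group R / mR differ by a congruence unit. -/
theorem finiteIndex_congruenceUnits [Module.Finite ℤ R] {m : ℕ} (hm : 0 < m) :
    (congruenceUnits R m).FiniteIndex := by
  have hfin : Finite (R ⧸ (nsmulAddMonoidHom (α := R) m).range) := by
    have : Module.Finite ℤ (R ⧸ (nsmulAddMonoidHom (α := R) m).range) :=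
      Module.Finite.of_surjective
        (QuotientAddGroup.mk' (nsmulAddMonoidHom (α := R) m).range).toIntLinearMap
        (QuotientAddGroup.mk'_surjective _)
    refine Module.finite_of_fg_torsion _ fun {x} => ?_
    obtain ⟨x, rfl⟩ := QuotientAddGroup.mk_surjective x
    refine ⟨⟨(m : ℤ), mem_nonZeroDivisors_of_ne_zero (Int.natCast_ne_zero.mpr hm.ne')⟩, ?_⟩
    change (m : ℤ) • (QuotientAddGroup.mk x : R ⧸ (nsmulAddMonoidHom (α := R) m).range) = 0
    rw [natCast_zsmul, ← QuotientAddGroup.mk_nsmul, QuotientAddGroup.eq_zero_iff]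
    exact ⟨x, rfl⟩
  refine @Subgroup.finiteIndex_of_finite_quotient _ _ _ ?_
  have key : ∀ u v : Rˣ, (QuotientAddGroup.mk (u : R) :
      R ⧸ (nsmulAddMonoidHom (α := R) m).range) = QuotientAddGroup.mk (v : R) →
      u⁻¹ * v ∈ congruenceUnits R m := by
    intro u v h
    obtain ⟨θ, hθ⟩ := QuotientAddGroup.eq.mp h
    refine ⟨((u⁻¹ : Rˣ) : R) * θ, ?_⟩
    have hθ' : m • θ = -(u : R) + v := hθ
    rw [← mul_smul_comm, hθ', mul_add, mul_neg, Units.inv_mul]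
    push_cast; abel
  refine Finite.of_injective (fun q : Rˣ ⧸ congruenceUnits R m =>
    (QuotientAddGroup.mk (q.out : R) : R ⧸ (nsmulAddMonoidHom (α := R) m).range)) ?_
  intro p q h
  have := QuotientGroup.eq.mpr (key _ _ h)
  rwa [QuotientGroup.out_eq', QuotientGroup.out_eq'] at this

theorem exists_pow_mem_congruenceUnits [Module.Finite ℤ R] {m : ℕ} (hm : 0 < m) :
    ∃ e > 0, ∀ u : Rˣ, u ^ e ∈ congruenceUnits R m := by
  have := finiteIndex_congruenceUnits (R := R) hm
  exact ⟨_, Nat.pos_of_ne_zero Subgroup.FiniteIndex.index_ne_zero, Subgroup.pow_index_mem _⟩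

end CongruenceUnits

end NilpotentFiltration

/-! ### Approximation in unipotent groups and their normalizers -/

namespace NilFiltration

variable {R : Type u} [Ring R] (F : NilFiltration R)

theorem U_eq_bot {i : ℕ} (h : F.len ≤ i) : F.U i = ⊥ := by
  rw [eq_bot_iff, ← F.U_len]; exact F.U_antitone h

/-- Γ·U(j+2) is normal in Γ·U(j+1): an element of U(j+1) commutes modulo U(j+2) with everything in
U(1). -/
theorem conj_mem_sup_U {Γ : Subgroup Rˣ} (hΓ : Γ ≤ F.U 1) {j : ℕ} {y z : Rˣ}
    (hy : y ∈ Γ ⊔ F.U (j + 1)) (hz : z ∈ Γ ⊔ F.U (j + 2)) :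
    y * z * y⁻¹ ∈ Γ ⊔ F.U (j + 2) := by
  obtain ⟨γ, hγ, u, hu, rfl⟩ := Subgroup.mem_sup_of_normal_right.mp hy
  have hz1 : z ∈ F.U 1 := sup_le hΓ (F.U_antitone (by omega)) hz
  have h : γ * u * z * (γ * u)⁻¹ = γ * ((z * u * z⁻¹ * u⁻¹)⁻¹ * z) * γ⁻¹ := by group
  have hγ' : γ ∈ Γ ⊔ F.U (j + 2) := Subgroup.mem_sup_left hγ
  rw [h]
  exact mul_mem (mul_mem hγ' (mul_mem (inv_mem (Subgroup.mem_sup_right (F.commutator_mem hz1 hu)))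
    hz)) (inv_mem hγ')

variable [Module.Finite ℤ R]

theorem fg_quotient (i : ℕ) : Group.FG (Multiplicative (R ⧸ F.I i)) := by
  have : Module.Finite ℤ (R ⧸ F.I i) := Module.Finite.of_surjective
    (QuotientAddGroup.mk' (F.I i)).toIntLinearMap (QuotientAddGroup.mk'_surjective _)
  exact AddGroup.fg_iff_mul_fg.mp (Module.Finite.iff_addGroup_fg.mp this)

/-- Along the filtration X ∩ U(i+1), each successive quotient embeds through `gr` in a finitely
generated abelian group. -/
theorem fg_of_le_U {X : Subgroup Rˣ} (hX : X ≤ F.U 1) : Group.FG X := by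
  have key : ∀ k i : ℕ, F.len ≤ i + 1 + k → Group.FG ↥(X ⊓ F.U (i + 1)) := by
    intro k
    induction k with
    | zero =>
      intro i hi
      rw [F.U_eq_bot hi, inf_bot_eq]
      infer_instance
    | succ k ih =>
      intro i hi
      have := F.fg_quotient (i + 2)
      have ih' := ih (i + 1) (by omega)
      refine fg_of_ker_commGroup
        ((F.gr i).comp (Subgroup.inclusion (inf_le_right : X ⊓ F.U (i + 1) ≤ F.U (i + 1)))) ?_
      have hle : X ⊓ F.U (i + 2) ≤ X ⊓ F.U (i + 1) :=
        inf_le_inf_left _ (F.U_antitone (Nat.le_succ _))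
      refine Group.fg_of_surjective (f := (Subgroup.inclusion hle).codRestrict _
        fun x => F.gr_eq_one.mpr x.2.2) ?_
      rintro ⟨⟨x, hx⟩, hx'⟩
      exact ⟨⟨x, hx.1, F.gr_eq_one.mp hx'⟩, rfl⟩
  have := key F.len 0 (by omega)
  rwa [inf_eq_left.mpr hX] at this

/-- The congruence subgroup property of unipotent groups over ℤ. Descend one step of the filtration
at a time: `gr` is a homomorphism to an abelian group, and it sends elements of congruence level m
to m-th multiples, so `Approx.of_hom` applies. The filtration ends at the kernel of `ρ`. -/
theorem approx_ker {G : Type*} [Group G] (ρ : G →* Rˣ) {X : Subgroup G}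
    (hX : X ≤ (F.U 1).comap ρ) :
    Approx (fun m => (congruenceUnits R m).comap ρ) X (X ⊓ ρ.ker) := by
  have key : ∀ k, Approx (fun m => (congruenceUnits R m).comap ρ) X
      (X ⊓ (F.U (k + 1)).comap ρ) := by
    intro k
    induction k with
    | zero => exact (Approx.refl _ X).mono (le_inf le_rfl hX)
    | succ k ih =>
      refine ih.trans (fun a b h => Subgroup.comap_mono (congruenceUnits_anti h))
        (fun m hm => ?_) inf_le_left ?_
      · obtain ⟨e, he, H⟩ := exists_pow_mem_congruenceUnits (R := R) hm
        exact ⟨e, he, fun g => by rw [Subgroup.mem_comap, map_pow]; exact H _⟩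
      · have := F.fg_quotient (k + 2)
        refine Approx.of_hom ((F.gr k).comp ((ρ.comp (Subgroup.subtype _)).codRestrict _
          fun x : ↥(X ⊓ (F.U (k + 1)).comap ρ) => x.2.2)) (fun m hm => ⟨m, hm, ?_⟩) ?_
        · rintro a ⟨θ, hθ⟩
          refine ⟨Multiplicative.ofAdd (QuotientAddGroup.mk θ), ?_⟩
          change Multiplicative.ofAdd (QuotientAddGroup.mk ((ρ a : R) - 1)) = _
          rw [hθ, QuotientAddGroup.mk_nsmul, ofAdd_nsmul]
        · intro a ha
          exact ⟨a.2.1, F.gr_eq_one.mp ha⟩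
  refine (key F.len).mono (inf_le_inf_left _ fun x hx => ?_)
  rw [Subgroup.mem_comap, F.U_eq_bot (Nat.le_succ _)] at hx
  exact hx

/-- Γ·U(j+1) / Γ·U(j+2) is a quotient of U(j+1) in which the kernel of `gr` dies, hence abelian and
finitely generated. The quotient map is given as a total function, equal to 1 outside Γ·U(j+1), so
that it applies directly to units. -/
theorem exists_abelian_quotient {Γ : Subgroup Rˣ} (hΓ : Γ ≤ F.U 1) (j : ℕ) :
    ∃ (W : Type u) (_ : CommGroup W) (_ : Group.FG W) (Q : Rˣ → W),
      (∀ a ∈ Γ ⊔ F.U (j + 1), ∀ b ∈ Γ ⊔ F.U (j + 1), Q (a * b) = Q a * Q b) ∧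
      ∀ a ∈ Γ ⊔ F.U (j + 1), (Q a = 1 ↔ a ∈ Γ ⊔ F.U (j + 2)) := by
  classical
  let Y := Γ ⊔ F.U (j + 1)
  let Z := (Γ ⊔ F.U (j + 2)).subgroupOf Y
  have hn : Z.Normal := ⟨fun z hz y => F.conj_mem_sup_U hΓ y.2 hz⟩
  let f : F.U (j + 1) →* Y ⧸ Z :=
    (QuotientGroup.mk' Z).comp (Subgroup.inclusion le_sup_right)
  have hf : Function.Surjective f := by
    intro w
    obtain ⟨⟨y, hy⟩, rfl⟩ := QuotientGroup.mk_surjective w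
    obtain ⟨u, hu, γ, hγ, rfl⟩ := Subgroup.mem_sup_of_normal_left.mp
      (show y ∈ F.U (j + 1) ⊔ Γ by rwa [sup_comm])
    refine ⟨⟨u, hu⟩, QuotientGroup.eq.mpr ?_⟩
    change u⁻¹ * (u * γ) ∈ Γ ⊔ F.U (j + 2)
    rw [inv_mul_cancel_left]
    exact Subgroup.mem_sup_left hγ
  have hk : (F.gr j).ker ≤ f.ker := by
    intro u hu
    refine (QuotientGroup.eq_one_iff _).mpr ?_
    exact Subgroup.mem_sup_right (F.gr_eq_one.mp hu)
  have hcomm : ∀ a b : Y ⧸ Z, a * b = b * a := by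
    intro a b
    obtain ⟨u, rfl⟩ := hf a
    obtain ⟨v, rfl⟩ := hf b
    have : u * v * (v * u)⁻¹ ∈ f.ker := by
      refine hk ?_
      rw [MonoidHom.mem_ker, map_mul, map_inv, map_mul, map_mul, mul_comm (F.gr j v),
        mul_inv_cancel]
    rw [MonoidHom.mem_ker, map_mul, map_inv, mul_inv_eq_one, map_mul, map_mul] at this
    exact this
  let inst : CommGroup (Y ⧸ Z) := { (inferInstance : Group (Y ⧸ Z)) with mul_comm := hcomm }
  have := F.fg_quotient (j + 2)
  refine ⟨Y ⧸ Z, inst, fg_of_surjective_of_ker_le f hf (F.gr j) hk,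
    fun a => if h : a ∈ Y then QuotientGroup.mk ⟨a, h⟩ else 1, ?_, ?_⟩
  · intro a ha b hb
    beta_reduce
    rw [dif_pos (show a ∈ Y from ha), dif_pos (show b ∈ Y from hb),
      dif_pos (show a * b ∈ Y from mul_mem ha hb)]
    rfl
  · intro a ha
    beta_reduce
    rw [dif_pos (show a ∈ Y from ha)]
    exact QuotientGroup.eq_one_iff (N := Z) _

/-- The elements of `L` acting trivially by conjugation on the abelian section `Y / Z`. -/
theorem approx_commutator {S : ℕ → Subgroup Rˣ} (hS : ∀ a b, a ∣ b → S b ≤ S a)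
    (hpow : ∀ m > 0, ∃ e > 0, ∀ g, g ^ e ∈ S m) {L Y Z : Subgroup Rˣ}
    (hL : L ≤ F.U 1) (hY : Y ≤ F.U 1) {W : Type*} [CommGroup W] [Group.FG W] (Q : Rˣ → W)
    (hQ : ∀ a ∈ Y, ∀ b ∈ Y, Q (a * b) = Q a * Q b) (hQZ : ∀ a ∈ Y, (Q a = 1 ↔ a ∈ Z))
    (hLY : ∀ k ∈ L, ∀ y ∈ Y, k * y * k⁻¹ ∈ Y)
    (hdeep : ∀ m > 0, ∃ m' > 0, ∀ k ∈ L, k ∈ S m' → ∀ y ∈ Y, ∃ w, Q (k * y * k⁻¹ * y⁻¹) = w ^ m) :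
    ∃ L' ≤ L, Approx S L L' ∧ ∀ k ∈ L', ∀ y ∈ Y, k * y * k⁻¹ * y⁻¹ ∈ Z := by
  have hc : ∀ k ∈ L, ∀ y ∈ Y, k * y * k⁻¹ * y⁻¹ ∈ Y := fun k hk y hy =>
    mul_mem (hLY k hk y hy) (inv_mem hy)
  have hQ1 : Q 1 = 1 := by
    have := hQ 1 Y.one_mem 1 Y.one_mem
    rw [mul_one] at this
    exact left_eq_mul.mp this
  have hQi : ∀ a ∈ Y, Q a⁻¹ = (Q a)⁻¹ := fun a ha => by
    rw [eq_inv_iff_mul_eq_one, ← hQ _ (inv_mem ha) _ ha, inv_mul_cancel, hQ1]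
  -- Induction from the bottom of the filtration: once the commutators with `Y ⊓ F.U (i + 1)` lie in
  -- `Z`, shrink `L'` so that those with `Y ⊓ F.U i` do too.
  suffices key : ∀ t i : ℕ, F.len ≤ i + t → ∃ L' ≤ L, Approx S L L' ∧
      ∀ k ∈ L', ∀ y ∈ Y ⊓ F.U i, k * y * k⁻¹ * y⁻¹ ∈ Z by
    obtain ⟨L', h1, h2, h3⟩ := key F.len 1 (by omega)
    exact ⟨L', h1, h2, fun k hk y hy => h3 k hk y ⟨hy, hY hy⟩⟩
  intro t
  induction t with
  | zero =>
    intro i hi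
    refine ⟨L, le_rfl, Approx.refl _ _, fun k hk y hy => ?_⟩
    have : y = 1 := by
      have : y ∈ F.U i := hy.2
      rwa [F.U_eq_bot (i := i) hi, Subgroup.mem_bot] at this
    simp [this]
  | succ t ih =>
    intro i hi
    obtain ⟨L', hL', hA, hL'Z⟩ := ih (i + 1) (by omega)
    have hfg := F.fg_of_le_U (X := Y ⊓ F.U i) (inf_le_left.trans hY)
    obtain ⟨T, hT, hTf⟩ := Group.fg_iff.mp hfg
    have := hTf.to_subtype
    -- k ↦ Q([k, y]) is multiplicative on `L'`: the defect is [k, z] with z = [k', y] one step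
    -- deeper, where `L'` already acts trivially modulo `Z`.
    have hmul : ∀ k ∈ L', ∀ k' ∈ L', ∀ y ∈ Y ⊓ F.U i, Q (k * k' * y * (k * k')⁻¹ * y⁻¹) =
        Q (k * y * k⁻¹ * y⁻¹) * Q (k' * y * k'⁻¹ * y⁻¹) := by
      intro k hk k' hk' y hy
      have hz : k' * y * k'⁻¹ * y⁻¹ ∈ Y ⊓ F.U (i + 1) :=
        ⟨hc _ (hL' hk') _ hy.1, F.commutator_mem (hL (hL' hk')) hy.2⟩
      set z := k' * y * k'⁻¹ * y⁻¹
      have h1 : k * k' * y * (k * k')⁻¹ * y⁻¹ =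
          k * z * k⁻¹ * z⁻¹ * z * (k * y * k⁻¹ * y⁻¹) := by simp only [z]; group
      have h2 := hc _ (hL' hk) _ hz.1
      rw [h1, hQ _ (mul_mem h2 hz.1) _ (hc _ (hL' hk) _ hy.1), hQ _ h2 _ hz.1,
        (hQZ _ h2).mpr (hL'Z k hk z hz), one_mul, mul_comm]
    let h : L' →* (T → W) :=
      { toFun := fun k s => Q (k * (s : ↥(Y ⊓ F.U i)) * (k : Rˣ)⁻¹ * ((s : ↥(Y ⊓ F.U i)) : Rˣ)⁻¹)
        map_one' := by
          funext s
          simp [hQ1]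
        map_mul' := fun k k' => by
          funext s
          exact hmul k k.2 k' k'.2 _ s.1.2 }
    refine ⟨h.ker.map L'.subtype, (Subgroup.map_subtype_le _).trans hL', ?_, ?_⟩
    · refine hA.trans hS hpow hL' (Approx.of_hom h (fun m hm => ?_) ?_)
      · obtain ⟨m', hm', H⟩ := hdeep m hm
        refine ⟨m', hm', fun k hk => ?_⟩
        choose w hw using fun s : T => H k (hL' k.2) hk _ s.1.2.1
        exact ⟨w, funext hw⟩
      · intro k hk
        exact ⟨k, hk, rfl⟩
    · rintro _ ⟨k, hk, rfl⟩ y hy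
      have hkL : (k : Rˣ) ∈ L := hL' k.2
      -- For fixed k, y ↦ Q([k, y]) is also a homomorphism, as conjugation by x disappears in `W`.
      -- Its vanishing on the finite set `T` therefore suffices.
      let θ : ↥(Y ⊓ F.U i) →* W :=
        { toFun := fun y => Q (k * y * (k : Rˣ)⁻¹ * (y : Rˣ)⁻¹)
          map_one' := by simp [hQ1]
          map_mul' := fun x y => by
            have hx := hc _ hkL _ x.2.1
            have hy := hc _ hkL _ y.2.1
            have h1 : (k * ((x * y : ↥(Y ⊓ F.U i)) : Rˣ) * (k : Rˣ)⁻¹ *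
                ((x * y : ↥(Y ⊓ F.U i)) : Rˣ)⁻¹ : Rˣ) = (k * x * (k : Rˣ)⁻¹ * (x : Rˣ)⁻¹) *
                (x * (k * y * (k : Rˣ)⁻¹ * (y : Rˣ)⁻¹) * (x : Rˣ)⁻¹) := by
              push_cast; group
            rw [h1, hQ _ hx _ (mul_mem (mul_mem x.2.1 hy) (inv_mem x.2.1)),
              hQ _ (mul_mem x.2.1 hy) _ (inv_mem x.2.1), hQ _ x.2.1 _ hy, hQi _ x.2.1,
              mul_inv_cancel_comm] }
      have : θ = 1 := MonoidHom.eq_of_eqOn_dense hT fun s hs => congrFun hk ⟨s, hs⟩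
      exact (hQZ _ (hc _ hkL _ hy.1)).mp (DFunLike.congr_fun this ⟨y, hy⟩)

/-- Elements of `U 1` which are congruent to an element normalizing `Γ` can be approximated by
elements of `U 1` normalizing `Γ`. -/
theorem exists_mem_normalizer {Γ : Subgroup Rˣ} (hΓ : Γ ≤ F.U 1) {m' : ℕ} (hm' : 0 < m') :
    ∃ m > 0, ∀ k ∈ F.U 1, ∀ φ ∈ Subgroup.normalizer (Γ : Set Rˣ), φ⁻¹ * k ∈ congruenceUnits R m →
      ∃ κ ∈ F.U 1, κ ∈ Subgroup.normalizer (Γ : Set Rˣ) ∧ κ⁻¹ * k ∈ congruenceUnits R m' := by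
  -- Depth is measured modulo the normalizer: the given k is only congruent to a normalizing
  -- element, not to 1.
  let S : ℕ → Subgroup Rˣ := fun m => Subgroup.normalizer (Γ : Set Rˣ) ⊔ congruenceUnits R m
  have hS : ∀ a b, a ∣ b → S b ≤ S a := fun a b h => sup_le_sup_left (congruenceUnits_anti h) _
  have hpow : ∀ m > 0, ∃ e > 0, ∀ g, g ^ e ∈ S m := fun m hm =>
    let ⟨e, he, H⟩ := exists_pow_mem_congruenceUnits (R := R) hm
    ⟨e, he, fun g => Subgroup.mem_sup_right (H g)⟩
  have hX : ∀ j, Γ ⊔ F.U (j + 1) ≤ F.U 1 := fun j => sup_le hΓ (F.U_antitone (by omega))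
  -- Elements of `L` normalize Γ·U(j+1); this subgroup is all of U(1) for j = 0 and Γ itself for j =
  -- `F.len`.
  have key : ∀ j, ∃ L ≤ F.U 1, Approx S (F.U 1) L ∧
      ∀ k ∈ L, ∀ x ∈ Γ ⊔ F.U (j + 1), k * x * k⁻¹ ∈ Γ ⊔ F.U (j + 1) := by
    intro j
    induction j with
    | zero =>
      refine ⟨F.U 1, le_rfl, Approx.refl _ _, fun k hk x hx => ?_⟩
      rw [zero_add, sup_eq_right.mpr hΓ] at *
      exact mul_mem (mul_mem hk hx) (inv_mem hk)
    | succ j ih =>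
      obtain ⟨L, hL, hA, hLX⟩ := ih
      obtain ⟨W, _, _, Q, hQ, hQZ⟩ := F.exists_abelian_quotient hΓ j
      have hΓY : Γ ≤ Γ ⊔ F.U (j + 1) := le_sup_left
      have hZY : Γ ⊔ F.U (j + 2) ≤ Γ ⊔ F.U (j + 1) :=
        sup_le_sup_left (F.U_antitone (Nat.le_succ _)) _
      have hQ1 : Q 1 = 1 := (hQZ 1 (one_mem _)).mpr (one_mem _)
      have hQi : ∀ a ∈ Γ ⊔ F.U (j + 1), Q a⁻¹ = (Q a)⁻¹ := fun a ha => by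
        rw [eq_inv_iff_mul_eq_one, ← hQ _ (inv_mem ha) _ ha, inv_mul_cancel, hQ1]
      have hQpow : ∀ a ∈ Γ ⊔ F.U (j + 1), ∀ n : ℕ, Q (a ^ n) = Q a ^ n := by
        intro a ha n
        induction n with
        | zero => simpa using hQ1
        | succ n ih => rw [pow_succ, hQ _ (pow_mem ha n) _ ha, ih, pow_succ]
      obtain ⟨L', hL', hA', hL'Z⟩ := F.approx_commutator hS hpow hL (hX j) Q hQ hQZ hLX (by
        intro m hm
        let N : Subgroup Rˣ :=
          { carrier := {y | y ∈ Γ ⊔ F.U (j + 1) ∧ ∃ w, Q y = w ^ m}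
            one_mem' := ⟨one_mem _, 1, by rw [hQ1, one_pow]⟩
            mul_mem' := by
              rintro a b ⟨ha, v, hv⟩ ⟨hb, w, hw⟩
              exact ⟨mul_mem ha hb, v * w, by rw [hQ _ ha _ hb, hv, hw, mul_pow]⟩
            inv_mem' := by
              rintro a ⟨ha, v, hv⟩
              exact ⟨inv_mem ha, v⁻¹, by rw [hQi _ ha, hv, inv_pow]⟩ }
        -- With ρ the identity the kernel is trivial, so every element of Γ·U(j+1) of deep
        -- congruence level has `Q`-image an m-th power.
        obtain ⟨m', hm', H⟩ := F.approx_ker (MonoidHom.id Rˣ) (X := Γ ⊔ F.U (j + 1)) (hX j) N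
          ⟨m, hm, fun g hg => ⟨pow_mem hg m, Q g, hQpow g hg m⟩⟩
        refine ⟨m', hm', fun k hk hkS y hy => ?_⟩
        obtain ⟨φ, hφ, ψ, hψ, rfl⟩ := Subgroup.mem_sup_of_normal_right.mp hkS
        obtain ⟨γ, hγ, u, hu, rfl⟩ := Subgroup.mem_sup_of_normal_right.mp hy
        have hγ' := (Subgroup.mem_normalizer_iff.mp hφ γ).mp hγ
        -- For k = φψ one has kγk⁻¹ = c·φγφ⁻¹ with φγφ⁻¹ in Γ. So [k, γu] agrees with c modulo
        -- Γ·U(j+2), and c has deep congruence level because ψ has.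
        set c := φ * (ψ * γ * ψ⁻¹ * γ⁻¹) * φ⁻¹ with hc
        have hcC : c ∈ congruenceUnits R m' := by
          refine (congruenceUnits_normal m').conj_mem _ ?_ _
          rw [mul_assoc ψ, mul_assoc ψ]
          exact mul_mem hψ ((congruenceUnits_normal m').conj_mem _ (inv_mem hψ) _)
        have hc' : c = (φ * ψ) * γ * (φ * ψ)⁻¹ * (φ * γ * φ⁻¹)⁻¹ := by rw [hc]; group
        have hcY : c ∈ Γ ⊔ F.U (j + 1) := by
          rw [hc']
          exact mul_mem (hLX _ hk _ (hΓY hγ)) (inv_mem (hΓY hγ'))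
        obtain ⟨n, hn, hnc⟩ := H c hcY hcC
        have hnc : c = n := (inv_mul_eq_one.mp hnc.2).symm
        obtain ⟨w, hw⟩ := (hnc ▸ hn).2
        refine ⟨w, ?_⟩
        have hcomm := F.commutator_mem (hL hk) hu
        have hz : φ * γ * φ⁻¹ * ((φ * ψ) * u * (φ * ψ)⁻¹ * u⁻¹) * γ⁻¹ ∈ Γ ⊔ F.U (j + 2) :=
          mul_mem (mul_mem (Subgroup.mem_sup_left hγ') (Subgroup.mem_sup_right hcomm))
            (inv_mem (Subgroup.mem_sup_left hγ))
        have heq : φ * ψ * (γ * u) * (φ * ψ)⁻¹ * (γ * u)⁻¹ =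
            c * (φ * γ * φ⁻¹ * ((φ * ψ) * u * (φ * ψ)⁻¹ * u⁻¹) * γ⁻¹) := by rw [hc']; group
        rw [heq, hQ _ hcY _ (hZY hz), (hQZ _ (hZY hz)).mpr hz, mul_one, hw])
      refine ⟨L', hL'.trans hL, hA.trans hS hpow hL hA', fun k hk x hx => ?_⟩
      have := mul_mem (hL'Z k hk x (hZY hx)) hx
      rwa [inv_mul_cancel_right] at this
  obtain ⟨L, hL, hA, hLΓ⟩ := key F.len
  rw [F.U_eq_bot (Nat.le_succ _), sup_bot_eq] at hLΓ
  obtain ⟨e, he, hC⟩ := exists_pow_mem_congruenceUnits (R := R) hm'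
  obtain ⟨m, hm, H⟩ := hA (congruenceUnits R m') ⟨e, he, fun g _ => hC g⟩
  refine ⟨m, hm, fun k hk φ hφ hφk => ?_⟩
  have hkS : k ∈ S m := by
    have := Subgroup.mul_mem_sup hφ hφk
    rwa [mul_inv_cancel_left] at this
  obtain ⟨ν, hν, hκ⟩ := H k hk hkS
  -- With κ = ν⁻¹k, the element κ⁻¹k is the conjugate k⁻¹νk of a congruence unit.
  refine ⟨ν⁻¹ * k, hL hκ, Subgroup.mem_normalizer_iff.mpr fun g => ⟨fun hg => hLΓ _ hκ g hg,
    fun hg => ?_⟩, ?_⟩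
  · have := hLΓ _ (inv_mem hκ) _ hg
    convert this using 1
    group
  · have := (congruenceUnits_normal m').conj_mem _ hν k⁻¹
    convert this using 1
    group

end NilFiltration

/-! ### Integer-valued polynomial functions on a group -/

section PolynomialFunctions

variable {Γ : Type u} [Group Γ]

/-- Right translation of integer valued functions on a group. -/
def translate (x : Γ) : (Γ → ℤ) →ₗ[ℤ] (Γ → ℤ) := LinearMap.funLeft ℤ ℤ (· * x)

@[simp] theorem translate_apply (x : Γ) (f : Γ → ℤ) (g : Γ) : translate x f g = f (g * x) := rfl

theorem translate_mul (x y : Γ) (f : Γ → ℤ) : translate (x * y) f = translate x (translate y f) := by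
  funext g; simp [mul_assoc]

theorem translate_one (f : Γ → ℤ) : translate 1 f = f := by
  funext g; simp

variable (Γ) in
/-- The polynomial functions `Γ → ℤ` of degree less than `n`. -/
def polyFun : ℕ → Submodule ℤ (Γ → ℤ)
  | 0 => ⊥
  | n + 1 => ⨅ x : Γ, (polyFun n).comap (translate x - LinearMap.id)

@[simp] theorem mem_polyFun_zero {f : Γ → ℤ} : f ∈ polyFun Γ 0 ↔ f = 0 := Submodule.mem_bot _

theorem mem_polyFun_succ {n : ℕ} {f : Γ → ℤ} :
    f ∈ polyFun Γ (n + 1) ↔ ∀ x, translate x f - f ∈ polyFun Γ n := by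
  simp [polyFun, Submodule.mem_iInf]

theorem polyFun_le_succ (n : ℕ) : polyFun Γ n ≤ polyFun Γ (n + 1) := by
  induction n with
  | zero => exact bot_le
  | succ n ih => exact fun f hf => mem_polyFun_succ.mpr fun x => ih (mem_polyFun_succ.mp hf x)

theorem polyFun_mono : Monotone (polyFun Γ) := monotone_nat_of_le_succ polyFun_le_succ

theorem translate_mem_polyFun {n : ℕ} (x : Γ) {f : Γ → ℤ} (hf : f ∈ polyFun Γ n) :
    translate x f ∈ polyFun Γ n := by
  cases n with
  | zero => rw [mem_polyFun_zero] at hf ⊢; rw [hf, map_zero]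
  | succ n =>
    have := add_mem (polyFun_le_succ n (mem_polyFun_succ.mp hf x)) hf
    rwa [sub_add_cancel] at this

theorem comp_mem_polyFun {n : ℕ} (φ : MulAut Γ) {f : Γ → ℤ} (hf : f ∈ polyFun Γ n) :
    f ∘ φ ∈ polyFun Γ n := by
  induction n generalizing f with
  | zero => rw [mem_polyFun_zero] at hf ⊢; rw [hf]; rfl
  | succ n ih =>
    refine mem_polyFun_succ.mpr fun x => ?_
    have : translate x (f ∘ φ) - f ∘ φ = (translate (φ x) f - f) ∘ φ := by
      funext g; simp
    rw [this]
    exact ih (mem_polyFun_succ.mp hf _)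

/-- Purity: the quotient by the polynomial functions of bounded degree is torsion-free, which lets
difference maps factor through Γ* and allows division by m later. -/
theorem mem_polyFun_of_nsmul_mem {n m : ℕ} (hm : 0 < m) {f : Γ → ℤ} (hf : m • f ∈ polyFun Γ n) :
    f ∈ polyFun Γ n := by
  induction n generalizing f with
  | zero =>
    rw [mem_polyFun_zero] at hf ⊢
    exact (smul_eq_zero_iff_right hm.ne').mp hf
  | succ n ih =>
    refine mem_polyFun_succ.mpr fun x => ih ?_
    have := mem_polyFun_succ.mp hf x
    rwa [map_nsmul, ← smul_sub] at this

theorem eq_const_of_mem_polyFun_one {f : Γ → ℤ} (hf : f ∈ polyFun Γ 1) (x : Γ) : f x = f 1 := by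
  have := congrFun (mem_polyFun_zero.mp (mem_polyFun_succ.mp hf x)) 1
  simpa [sub_eq_zero] using this

theorem translate_mul_sub (x y : Γ) (f : Γ → ℤ) : translate (x * y) f - f =
    (translate x (translate y f - f) - (translate y f - f)) + (translate y f - f) +
      (translate x f - f) := by
  rw [translate_mul, map_sub]; abel

/-- The differences of a polynomial function define a homomorphism modulo lower degree. -/
theorem exists_differenceHom {n : ℕ} {f : Γ → ℤ} (hf : f ∈ polyFun Γ (n + 2)) :
    ∃ B : Γ →* Multiplicative ((Γ → ℤ) ⧸ polyFun Γ n), ∀ x,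
      B x = Multiplicative.ofAdd (Submodule.Quotient.mk (translate x f - f)) := by
  refine ⟨{ toFun := fun x => Multiplicative.ofAdd (Submodule.Quotient.mk (translate x f - f))
            map_one' := by simp [translate_one]
            map_mul' := fun x y => ?_ }, fun x => rfl⟩
  rw [← ofAdd_add, ← Submodule.Quotient.mk_add]
  refine congrArg _ ((Submodule.Quotient.eq _).mpr ?_)
  rw [translate_mul_sub]
  have := mem_polyFun_succ.mp (mem_polyFun_succ.mp hf y) x
  convert this using 1
  abel

/-- One degree above, differences modulo lower degree are additive in the group element, so they
vanish once they vanish on generators. -/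
theorem mem_polyFun_of_closure {n : ℕ} {f : Γ → ℤ} (hf : f ∈ polyFun Γ (n + 2)) {S : Set Γ}
    (hS : Subgroup.closure S = ⊤) (h : ∀ s ∈ S, translate s f - f ∈ polyFun Γ n) :
    f ∈ polyFun Γ (n + 1) := by
  obtain ⟨B, hB⟩ := exists_differenceHom hf
  have : B = 1 := MonoidHom.eq_of_eqOn_dense hS fun s hs => by
    rw [hB]
    exact (Submodule.Quotient.mk_eq_zero _).mpr (h s hs)
  refine mem_polyFun_succ.mpr fun x => ?_
  have := (hB x).symm.trans (DFunLike.congr_fun this x)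
  exact (Submodule.Quotient.mk_eq_zero _).mp this

/-- Taking differences along a finite generating set maps degree n + 1 into finitely many copies of
degree n, with only constants in the kernel. -/
instance finite_polyFun [Group.FG Γ] (n : ℕ) : Module.Finite ℤ (polyFun Γ n) := by
  obtain ⟨S, hS, hSf⟩ := Group.fg_iff.mp ‹Group.FG Γ›
  have := hSf.to_subtype
  have := Fintype.ofFinite S
  induction n with
  | zero => exact Module.Finite.iff_fg.mpr Submodule.fg_bot
  | succ n ih =>
    refine Module.Finite.iff_fg.mpr ?_
    let D : (Γ → ℤ) →ₗ[ℤ] (S → Γ → ℤ) := LinearMap.pi fun s => translate (s : Γ) - LinearMap.id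
    refine Submodule.fg_of_fg_map_of_fg_inf_ker D ?_ ?_
    · let E : (S → polyFun Γ n) →ₗ[ℤ] (S → Γ → ℤ) :=
        LinearMap.pi fun s => (polyFun Γ n).subtype.comp (LinearMap.proj s)
      refine isNoetherian_submodule.mp (isNoetherian_range E) _ ?_
      rintro _ ⟨f, hf, rfl⟩
      exact ⟨fun s => ⟨_, mem_polyFun_succ.mp hf s⟩, rfl⟩
    · have : IsNoetherian ℤ (Submodule.span ℤ {(1 : Γ → ℤ)}) :=
        isNoetherian_span_of_finite ℤ (Set.finite_singleton _)
      refine isNoetherian_submodule.mp this _ fun f hf => ?_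
      have hf' : ∀ s ∈ S, translate s f = f := fun s hs =>
        sub_eq_zero.mp (congrFun (LinearMap.mem_ker.mp hf.2) ⟨s, hs⟩)
      have hx : ∀ x, translate x f = f := by
        intro x
        have hx : x ∈ Subgroup.closure S := hS ▸ Subgroup.mem_top x
        induction hx using Subgroup.closure_induction with
        | mem s hs => exact hf' s hs
        | one => exact translate_one f
        | mul x y _ _ hx hy => rw [translate_mul, hy, hx]
        | inv x _ hx =>
          conv_lhs => rw [← hx]
          rw [← translate_mul, inv_mul_cancel, translate_one]
      refine Submodule.mem_span_singleton.mpr ⟨f 1, ?_⟩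
      funext x
      have := congrFun (hx x) 1
      simpa using this.symm

end PolynomialFunctions

/-! ### Control of the graded action on polynomials by Γ* -/

section Star

variable {Γ : Type u} [Group Γ]

/-- A homomorphism to a torsion-free abelian group factors through Γ*. -/
theorem map_eq_one_of_toStar_eq_one {C : Type*} [CommGroup C]
    (hC : ∀ (c : C) (k : ℕ), 0 < k → c ^ k = 1 → c = 1) (B : Γ →* C) {x : Γ}
    (hx : toStar Γ x = 1) : B x = 1 := by
  have h1 : Abelianization.of x ∈ CommGroup.torsion (Abelianization Γ) :=
    (QuotientGroup.eq_one_iff _).mp hx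
  obtain ⟨k, hk, hk1⟩ := isOfFinOrder_iff_pow_eq_one.mp (h1)
  refine hC _ k hk ?_
  have := congrArg (Abelianization.lift B) hk1
  simpa using this

/-- Modulo degree n the difference map of `f` is a homomorphism to a torsion-free group by purity,
so it sees only the classes in Γ*. -/
theorem exists_translate_sub {n m : ℕ} {f : Γ → ℤ} (hf : f ∈ polyFun Γ (n + 2)) {x y w : Γ}
    (h : toStar Γ x = toStar Γ y * toStar Γ w ^ m) :
    translate x f - translate y f - m • (translate w f - f) ∈ polyFun Γ n := by
  obtain ⟨B, hB⟩ := exists_differenceHom hf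
  have hC : ∀ (c : Multiplicative ((Γ → ℤ) ⧸ polyFun Γ n)) (k : ℕ), 0 < k → c ^ k = 1 →
      c = 1 := by
    intro c k hk hc
    obtain ⟨g, hg⟩ := Submodule.Quotient.mk_surjective _ c.toAdd
    have h1 : k • c.toAdd = 0 := hc
    rw [← hg, ← Submodule.Quotient.mk_smul, Submodule.Quotient.mk_eq_zero] at h1
    have := mem_polyFun_of_nsmul_mem hk h1
    rw [← Submodule.Quotient.mk_eq_zero, hg] at this
    exact this
  have h1 : B (x * (y * w ^ m)⁻¹) = 1 := by
    refine map_eq_one_of_toStar_eq_one hC B ?_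
    rw [map_mul, map_inv, map_mul, map_pow, h, mul_inv_cancel]
  rw [map_mul, map_inv, mul_inv_eq_one, map_mul, map_pow, hB, hB, hB, ← ofAdd_nsmul, ← ofAdd_add,
    ← Submodule.Quotient.mk_smul, ← Submodule.Quotient.mk_add] at h1
  have := (Submodule.Quotient.eq _).mp (Multiplicative.ofAdd.injective h1)
  convert this using 1
  abel

/-- `φ` acts trivially on `Γ*` modulo `m`-th powers. -/
def StarCongr (m : ℕ) (φ : MulAut Γ) : Prop :=
  ∀ y : Star Γ, ∃ z : Star Γ, starAut Γ φ y = y * z ^ m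

theorem StarCongr.of_dvd {a b : ℕ} (h : a ∣ b) {φ : MulAut Γ} (hφ : StarCongr b φ) :
    StarCongr a φ := by
  obtain ⟨c, rfl⟩ := h
  intro y
  obtain ⟨z, hz⟩ := hφ y
  exact ⟨z ^ c, by rw [hz, ← pow_mul, mul_comm c]⟩

theorem starCongr_zero_iff {φ : MulAut Γ} : StarCongr 0 φ ↔ starAut Γ φ = 1 := by
  simp [StarCongr, MulEquiv.ext_iff]

theorem StarCongr.exists_toStar {m : ℕ} {φ : MulAut Γ} (h : StarCongr m φ) (x : Γ) :
    ∃ w, toStar Γ x = toStar Γ (φ⁻¹ x) * toStar Γ w ^ m := by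
  obtain ⟨z, hz⟩ := h (toStar Γ (φ⁻¹ x))
  obtain ⟨w, rfl⟩ := toStar_surjective Γ z
  refine ⟨w, ?_⟩
  rw [← hz, starAut_toStar, MulAut.apply_inv_self]

/-- Splits a difference of f∘φ⁻¹ - f into the same expression for a function of lower degree,
handled by induction, and a term depending on how φ moves x, handled by `exists_translate_sub`. -/
theorem translate_comp_inv_sub (φ : MulAut Γ) (f : Γ → ℤ) (x : Γ) :
    translate x (f ∘ ⇑φ⁻¹ - f) - (f ∘ ⇑φ⁻¹ - f) =
      ((translate (φ⁻¹ x) f - f) ∘ ⇑φ⁻¹ - (translate (φ⁻¹ x) f - f)) -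
        (translate x f - translate (φ⁻¹ x) f) := by
  funext g
  simp only [Pi.sub_apply, translate_apply, Function.comp_apply, map_mul]
  ring

theorem comp_inv_sub_mem {φ : MulAut Γ} (hφ : starAut Γ φ = 1) {n : ℕ} {f : Γ → ℤ}
    (hf : f ∈ polyFun Γ (n + 1)) : f ∘ ⇑φ⁻¹ - f ∈ polyFun Γ n := by
  induction n generalizing f with
  | zero =>
    rw [mem_polyFun_zero]
    funext g
    exact sub_eq_zero.mpr ((eq_const_of_mem_polyFun_one hf _).trans
      (eq_const_of_mem_polyFun_one hf g).symm)
  | succ n ih =>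
    refine mem_polyFun_succ.mpr fun x => ?_
    rw [translate_comp_inv_sub]
    refine sub_mem (ih (mem_polyFun_succ.mp hf _)) ?_
    -- Triviality on Γ* is the case m = 0, in which the term in `w` vanishes.
    obtain ⟨w, hw⟩ := (starCongr_zero_iff.mpr hφ).exists_toStar x
    simpa using exists_translate_sub hf hw

/-- The approximate form of `comp_inv_sub_mem`: on each graded piece, an automorphism close to 1 on
Γ* acts as 1 modulo m'. -/
theorem exists_comp_inv_sub [Group.FG Γ] (n : ℕ) {m' : ℕ} (hm' : 0 < m') :
    ∃ m > 0, ∀ φ : MulAut Γ, StarCongr m φ → ∀ f ∈ polyFun Γ (n + 1),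
      ∃ f₁ ∈ polyFun Γ (n + 1), f ∘ ⇑φ⁻¹ - f - m' • f₁ ∈ polyFun Γ n := by
  induction n generalizing m' with
  | zero =>
    refine ⟨1, one_pos, fun φ _ f hf => ⟨0, zero_mem _, ?_⟩⟩
    rw [mem_polyFun_zero, smul_zero, sub_zero]
    funext g
    exact sub_eq_zero.mpr ((eq_const_of_mem_polyFun_one hf _).trans
      (eq_const_of_mem_polyFun_one hf g).symm)
  | succ n ih =>
    obtain ⟨S, hS, hSf⟩ := Group.fg_iff.mp ‹Group.FG Γ›
    have := hSf.to_subtype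
    have := Fintype.ofFinite S
    let P := (polyFun Γ n).submoduleOf (polyFun Γ (n + 1))
    -- By `mem_polyFun_of_closure` an element of the kernel of δ has lower degree, so δ detects the
    -- top graded piece in a finitely generated target.
    let δ : polyFun Γ (n + 2) →ₗ[ℤ] (S → polyFun Γ (n + 1) ⧸ P) :=
      LinearMap.pi fun s => P.mkQ.comp
        (((translate (s : Γ) - LinearMap.id).comp (polyFun Γ (n + 2)).subtype).codRestrict _
          fun f => mem_polyFun_succ.mp f.2 s)
    obtain ⟨m₁, hm₁, H₁⟩ := exists_nsmul_mem δ.range hm'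
    obtain ⟨m₂, hm₂, H₂⟩ := ih hm₁
    -- The factor m₂ serves the induction hypothesis and m₁ the displacement of the generators in
    -- Γ*. Together they make δ of f∘φ⁻¹ - f divisible by m₁, hence δ of an m'-th multiple.
    refine ⟨m₁ * m₂, Nat.mul_pos hm₁ hm₂, fun φ hφ f hf => ?_⟩
    have hF : f ∘ ⇑φ⁻¹ - f ∈ polyFun Γ (n + 2) := sub_mem (comp_mem_polyFun _ hf) hf
    have hs : ∀ s : S, ∃ v : polyFun Γ (n + 1), δ ⟨_, hF⟩ s = m₁ • P.mkQ v := by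
      intro s
      obtain ⟨f₁, hf₁, h₁⟩ := H₂ φ (hφ.of_dvd (dvd_mul_left _ _)) _
        (mem_polyFun_succ.mp hf (φ⁻¹ s))
      obtain ⟨w, hw⟩ := (hφ.of_dvd (dvd_mul_right _ _)).exists_toStar (s : Γ)
      have h₂ := exists_translate_sub hf hw
      refine ⟨⟨f₁, hf₁⟩ - ⟨_, mem_polyFun_succ.mp hf w⟩, ?_⟩
      rw [← map_nsmul]
      refine (Submodule.Quotient.eq P).mpr ?_
      change (translate (s : Γ) (f ∘ ⇑φ⁻¹ - f) - (f ∘ ⇑φ⁻¹ - f)) -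
        m₁ • (f₁ - (translate w f - f)) ∈ polyFun Γ n
      rw [translate_comp_inv_sub]
      convert sub_mem h₁ h₂ using 1
      rw [smul_sub]
      abel
    choose v hv using hs
    obtain ⟨_, ⟨f', rfl⟩, hf'⟩ := H₁ (fun s => P.mkQ (v s)) ⟨⟨_, hF⟩, funext hv⟩
    refine ⟨f', f'.2, mem_polyFun_of_closure (sub_mem hF (nsmul_mem f'.2 _)) hS fun s hs => ?_⟩
    have : δ (⟨_, hF⟩ - m' • f') = 0 := by
      rw [map_sub, map_nsmul, ← hf', sub_eq_zero]
      exact funext hv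
    exact (Submodule.Quotient.mk_eq_zero P).mp (congrFun this ⟨s, hs⟩)

end Star

/-! ### Γ and Aut(Γ) inside the units of a filtered endomorphism ring -/

noncomputable section Representation

variable (Γ : Type u) [Group Γ] (n : ℕ)

/-- The ring of endomorphisms of the polynomial functions of degree less than `n` which do not
increase degrees. -/
def filteredEnd : Subring (Module.End ℤ (polyFun Γ n)) where
  carrier := {θ | ∀ (j : ℕ) (v : polyFun Γ n), v.1 ∈ polyFun Γ j → (θ v).1 ∈ polyFun Γ j}
  mul_mem' ha hb j v hv := ha j _ (hb j v hv)
  one_mem' _ _ hv := hv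
  add_mem' ha hb j v hv := add_mem (ha j v hv) (hb j v hv)
  zero_mem' _ _ _ := zero_mem _
  neg_mem' ha j v hv := neg_mem (ha j v hv)

instance finite_filteredEnd [Group.FG Γ] : Module.Finite ℤ (filteredEnd Γ n) :=
  Module.Finite.of_injective (filteredEnd Γ n).subtype.toAddMonoidHom.toIntLinearMap
    Subtype.coe_injective

/-- The filtration of `filteredEnd` by the amount by which degrees are lowered. -/
def endFiltration : NilFiltration (filteredEnd Γ n) where
  I i :=
    { carrier := {θ | ∀ (j : ℕ) (v : polyFun Γ n), v.1 ∈ polyFun Γ (j + i) →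
        (θ.1 v).1 ∈ polyFun Γ j}
      add_mem' := fun ha hb j v hv => add_mem (ha j v hv) (hb j v hv)
      zero_mem' := fun _ _ _ => zero_mem _
      neg_mem' := fun ha j v hv => neg_mem (ha j v hv) }
  anti i _ hθ j v hv := hθ j v (polyFun_mono (Nat.le_succ _) hv)
  zero := eq_top_iff.mpr fun θ _ => θ.2
  len := n
  bot := by
    refine eq_bot_iff.mpr fun θ hθ => Subtype.ext (LinearMap.ext fun v => Subtype.ext ?_)
    exact mem_polyFun_zero.mp (hθ 0 v (by rw [zero_add]; exact v.2))
  mul {i j a b} ha hb k v hv := ha k _ (hb (k + i) v (by rwa [add_assoc]))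

/-- The action of a group on its polynomial functions by right translations. -/
def transRep : Γ →* (filteredEnd Γ n)ˣ := MonoidHom.toHomUnits
  { toFun := fun x => ⟨(translate x).restrict fun _ hf => translate_mem_polyFun x hf,
      fun _ _ hv => translate_mem_polyFun x hv⟩
    map_one' := Subtype.ext (LinearMap.ext fun v => Subtype.ext (translate_one v.1))
    map_mul' := fun x y =>
      Subtype.ext (LinearMap.ext fun v => Subtype.ext (translate_mul x y v.1)) }

/-- The action of the automorphisms of a group on its polynomial functions. -/
def autRep : MulAut Γ →* (filteredEnd Γ n)ˣ := MonoidHom.toHomUnits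
  { toFun := fun φ => ⟨(LinearMap.funLeft ℤ ℤ ⇑φ⁻¹).restrict fun _ hf => comp_mem_polyFun φ⁻¹ hf,
      fun _ _ hv => comp_mem_polyFun φ⁻¹ hv⟩
    map_one' := rfl
    map_mul' := fun φ ψ => by
      refine Subtype.ext (LinearMap.ext fun v => Subtype.ext (funext fun g => ?_))
      change v.1 ((φ * ψ)⁻¹ g) = v.1 (ψ⁻¹ (φ⁻¹ g))
      rw [mul_inv_rev]; rfl }

variable {Γ n}

theorem transRep_apply (x : Γ) (v : polyFun Γ n) :
    ((transRep Γ n x : filteredEnd Γ n).1 v).1 = translate x v.1 := rfl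

theorem autRep_conj (φ : MulAut Γ) (x : Γ) :
    autRep Γ n φ * transRep Γ n x * (autRep Γ n φ)⁻¹ = transRep Γ n (φ x) := by
  rw [mul_inv_eq_iff_eq_mul]
  refine Units.ext (Subtype.ext (LinearMap.ext fun v => Subtype.ext (funext fun g => ?_)))
  change v.1 (φ⁻¹ g * x) = v.1 (φ⁻¹ (g * φ x))
  rw [map_mul, MulAut.inv_apply_self]

theorem transRep_mem_U (x : Γ) : transRep Γ n x ∈ (endFiltration Γ n).U 1 :=
  fun _ _ hv => mem_polyFun_succ.mp hv x

theorem autRep_mem_U {φ : MulAut Γ} (hφ : starAut Γ φ = 1) :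
    autRep Γ n φ ∈ (endFiltration Γ n).U 1 :=
  fun _ _ hv => comp_inv_sub_mem hφ hv

theorem transRep_eq_one_iff {x : Γ} : transRep Γ n x = 1 ↔
    ∀ f ∈ polyFun Γ n, translate x f = f := by
  refine ⟨fun h f hf => ?_, fun h => ?_⟩
  · rw [← transRep_apply x ⟨f, hf⟩, h]; rfl
  · exact Units.ext (Subtype.ext (LinearMap.ext fun v => Subtype.ext (h v.1 v.2)))

/-- An endomorphism with values divisible by `m` is a multiple of `m`. -/
theorem exists_eq_nsmul {m : ℕ} (hm : 0 < m) {θ : filteredEnd Γ n}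
    (h : ∀ (v : polyFun Γ n) (g : Γ), (m : ℤ) ∣ (θ.1 v).1 g) :
    ∃ η : filteredEnd Γ n, θ = m • η := by
  have key : ∀ v : polyFun Γ n, m • (fun g => (θ.1 v).1 g / m) = (θ.1 v).1 := fun v =>
    funext fun g => by
      rw [Pi.smul_apply, nsmul_eq_mul]
      exact Int.mul_ediv_cancel' (h v g)
  -- The pointwise quotient by m is again polynomial of the same degree, by purity.
  let η : Module.End ℤ (polyFun Γ n) :=
    { toFun := fun v => ⟨fun g => (θ.1 v).1 g / m,
        mem_polyFun_of_nsmul_mem hm (by rw [key]; exact (θ.1 v).2)⟩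
      map_add' := fun v w => Subtype.ext <| funext fun g => by
        change (θ.1 (v + w)).1 g / (m : ℤ) = (θ.1 v).1 g / m + (θ.1 w).1 g / m
        rw [map_add]
        exact Int.add_ediv_of_dvd_left (h v g)
      map_smul' := fun c v => Subtype.ext <| funext fun g => by
        change (θ.1 (c • v)).1 g / (m : ℤ) = c * ((θ.1 v).1 g / m)
        rw [map_smul]
        exact Int.mul_ediv_assoc c (h v g) }
  refine ⟨⟨η, fun j v hv => mem_polyFun_of_nsmul_mem hm ?_⟩, ?_⟩
  · change m • (fun g => (θ.1 v).1 g / m) ∈ _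
    rw [key]
    exact θ.2 j v hv
  · exact Subtype.ext (LinearMap.ext fun v => Subtype.ext (key v).symm)

/-- At g = φ(x), the change of v under φ is, up to sign, the difference of v at x along x⁻¹φ(x). A
pointwise divisibility suffices by `exists_eq_nsmul`, so no uniformity in x is needed. -/
theorem autRep_mem_congruenceUnits {m : ℕ} (hm : 0 < m) {φ : MulAut Γ}
    (h : ∀ x, transRep Γ n (x⁻¹ * φ x) ∈ congruenceUnits (filteredEnd Γ n) m) :
    autRep Γ n φ ∈ congruenceUnits (filteredEnd Γ n) m := by
  refine exists_eq_nsmul hm fun v g => ?_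
  obtain ⟨θ, hθ⟩ := h (φ⁻¹ g)
  have h1 := congrArg (fun η : filteredEnd Γ n => (η.1 v).1 (φ⁻¹ g)) hθ
  have h2 : v.1 (φ⁻¹ g * ((φ⁻¹ g)⁻¹ * φ (φ⁻¹ g))) - v.1 (φ⁻¹ g) = m • (θ.1 v).1 (φ⁻¹ g) := h1
  rw [mul_inv_cancel_left, MulAut.apply_inv_self, nsmul_eq_mul] at h2
  change (m : ℤ) ∣ v.1 (φ⁻¹ g) - v.1 g
  exact ⟨-(θ.1 v).1 (φ⁻¹ g), by rw [mul_neg, ← h2, neg_sub]⟩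

/-- An automorphism which is close to the identity on `Γ*` is close to a unipotent element. -/
theorem exists_unipotent_congr (Γ : Type u) [Group Γ] [Group.FG Γ] (n : ℕ) {m' : ℕ} (hm' : 0 < m') :
    ∃ m > 0, ∀ φ : MulAut Γ, StarCongr m φ → ∃ k ∈ (endFiltration Γ n).U 1,
      (autRep Γ n φ)⁻¹ * k ∈ congruenceUnits (filteredEnd Γ n) m' := by
  classical
  let V := polyFun Γ n
  let P : ℕ → Submodule ℤ V := fun j => (polyFun Γ j).submoduleOf (polyFun Γ n)
  choose T hT using fun j => (IsNoetherian.noetherian (P j) : (P j).FG)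
  -- δ records the action from each degree to the next graded piece on finitely many generators; its
  -- kernel lowers degrees, and its target is finitely generated, so Artin–Rees applies to its
  -- range.
  let δ : filteredEnd Γ n →ₗ[ℤ] (∀ j : Fin n, T (j + 1) → V ⧸ P j) := AddMonoidHom.toIntLinearMap
    { toFun := fun θ j t => Submodule.Quotient.mk (θ.1 t.1)
      map_zero' := rfl
      map_add' := fun _ _ => rfl }
  have hδ : ∀ θ, δ θ = 0 → θ ∈ (endFiltration Γ n).I 1 := by
    intro θ hθ j v hv
    by_cases hj : j < n
    · have : P (j + 1) ≤ (P j).comap θ.1 := by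
        rw [← hT (j + 1), Submodule.span_le]
        intro t ht
        exact (Submodule.Quotient.mk_eq_zero (P j)).mp
          (congrFun (congrFun hθ ⟨j, hj⟩) ⟨t, ht⟩)
      exact this hv
    · exact polyFun_mono (not_lt.mp hj) (θ.1 v).2
  obtain ⟨m₁, hm₁, H₁⟩ := exists_nsmul_mem δ.range hm'
  choose m hm H using fun j : Fin n => exists_comp_inv_sub (Γ := Γ) j hm₁
  refine ⟨∏ j, m j, Finset.prod_pos fun j _ => hm j, fun φ hφ => ?_⟩
  set a : filteredEnd Γ n := (autRep Γ n φ : filteredEnd Γ n)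
  have hw : ∃ w, δ (a - 1) = m₁ • w := by
    have : ∀ (j : Fin n) (t : T (j + 1)), ∃ w : V ⧸ P j, δ (a - 1) j t = m₁ • w := by
      intro j t
      have ht : t.1.1 ∈ polyFun Γ (j + 1) := by
        have : t.1 ∈ P (j + 1) := by rw [← hT (j + 1)]; exact Submodule.subset_span t.2
        exact this
      obtain ⟨f₁, hf₁, h⟩ := H j φ (hφ.of_dvd (Finset.dvd_prod_of_mem _ (Finset.mem_univ j))) _ ht
      refine ⟨Submodule.Quotient.mk ⟨f₁, polyFun_mono j.2 hf₁⟩, ?_⟩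
      exact (Submodule.Quotient.eq (P j)).mpr h
    choose w hw using this
    exact ⟨w, funext fun j => funext fun t => hw j t⟩
  obtain ⟨w, hw⟩ := hw
  obtain ⟨_, ⟨θ, rfl⟩, hθ⟩ := H₁ w (by rw [← hw]; exact ⟨_, rfl⟩)
  have hκ : a - 1 - m' • θ ∈ (endFiltration Γ n).I 1 :=
    hδ _ (by rw [map_sub, map_nsmul, ← hθ, hw, sub_self])
  -- Subtracting m'θ removes the graded part of a - 1. What remains is nilpotent, and k = 1 + κ is a
  -- unipotent unit congruent to a modulo m'.
  set κ := a - 1 - m' • θ with hκdef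
  have hnil : IsNilpotent κ := by
    have : ∀ i, κ ^ i ∈ (endFiltration Γ n).I i := by
      intro i
      induction i with
      | zero => exact (endFiltration Γ n).mem_zero _
      | succ i ih => rw [pow_succ]; exact (endFiltration Γ n).mul ih hκ
    refine ⟨n, ?_⟩
    have := this n
    rw [show (endFiltration Γ n).I n = ⊥ from (endFiltration Γ n).bot] at this
    exact this
  obtain ⟨k, hk⟩ := hnil.isUnit_one_add
  refine ⟨k, ?_, -(((autRep Γ n φ)⁻¹ : (filteredEnd Γ n)ˣ) * θ), ?_⟩
  · rw [NilFiltration.mem_U, hk, add_sub_cancel_left]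
    exact hκ
  · have h1 : (k : filteredEnd Γ n) = a - m' • θ := by rw [hk, hκdef]; abel
    rw [Units.val_mul, h1, mul_sub, Units.inv_mul, mul_smul_comm, smul_neg]
    abel

end Representation

/-! ### The two approximation theorems for automorphisms -/

section Congruence

variable {Γ : Type u} [Group Γ]

theorem mem_ker_quotientAut {M : Subgroup Γ} [M.Normal] [M.Characteristic] {φ : MulAut Γ} :
    φ ∈ (quotientAut M).ker ↔ ∀ x, x⁻¹ * φ x ∈ M := by
  refine ⟨fun h x => ?_, fun h => ?_⟩
  · have := DFunLike.congr_fun (MonoidHom.mem_ker.mp h) (x : Γ ⧸ M)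
    rw [quotientAut_mk] at this
    exact QuotientGroup.eq.mp this.symm
  · rw [MonoidHom.mem_ker]
    ext x
    induction x using QuotientGroup.induction_on with | H x => ?_
    rw [quotientAut_mk]
    exact (QuotientGroup.eq.mpr (h x)).symm

instance finiteIndex_ker_quotientAut (M : Subgroup Γ) [M.Normal] [M.Characteristic]
    [M.FiniteIndex] : (quotientAut M).ker.FiniteIndex := by
  have : Finite (MulAut (Γ ⧸ M)) :=
    Finite.of_injective (fun e => (e : Γ ⧸ M → Γ ⧸ M)) DFunLike.coe_injective
  infer_instance

/-- The polynomial functions of degree less than `n` separate the points of a subgroup of finite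
index. -/
def PolySeparated (Γ : Type u) [Group Γ] (n : ℕ) : Prop :=
  ∃ H : Subgroup Γ, H.FiniteIndex ∧ ∀ x ∈ H, (∀ f ∈ polyFun Γ n, translate x f = f) → x = 1

theorem PolySeparated.mono {n m : ℕ} (h : PolySeparated Γ n) (hnm : n ≤ m) : PolySeparated Γ m :=
  let ⟨H, hH, hs⟩ := h
  ⟨H, hH, fun x hx hf => hs x hx fun f hfn => hf f (polyFun_mono hnm hfn)⟩

/-- An element of the congruence units normalizing the image of `Γ` and close to `1` is
induced by an automorphism of `Γ`. -/
theorem exists_hom_of_conj {n : ℕ} {M : Subgroup Γ} [M.Normal]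
    (hM : ∀ x ∈ M, transRep Γ n x = 1 → x = 1) {ψ : (filteredEnd Γ n)ˣ}
    (hψ : ∀ x, ∃ y, ψ * transRep Γ n x * ψ⁻¹ = transRep Γ n y ∧ x⁻¹ * y ∈ M) :
    ∃ f : Γ →* Γ, ∀ x, ψ * transRep Γ n x * ψ⁻¹ = transRep Γ n (f x) ∧ x⁻¹ * f x ∈ M := by
  have huniq : ∀ x y z, x⁻¹ * y ∈ M → x⁻¹ * z ∈ M → transRep Γ n y = transRep Γ n z → y = z := by
    intro x y z hy hz h
    have h1 : y⁻¹ * z ∈ M := by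
      have := mul_mem (inv_mem hy) hz
      rwa [mul_inv_rev, inv_inv, mul_assoc, mul_inv_cancel_left] at this
    exact inv_mul_eq_one.mp (hM _ h1 (by rw [map_mul, map_inv, h, inv_mul_cancel]))
  choose f hf hfM using hψ
  refine ⟨MonoidHom.mk' f fun x y => ?_, fun x => ⟨hf x, hfM x⟩⟩
  refine huniq (x * y) _ _ (hfM _) ?_ ?_
  · have h1 : (x * y)⁻¹ * (f x * f y) = y⁻¹ * (x⁻¹ * f x) * y⁻¹⁻¹ * (y⁻¹ * f y) := by group
    rw [h1]
    exact mul_mem (Subgroup.Normal.conj_mem ‹_› _ (hfM x) _) (hfM y)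
  · rw [← hf, map_mul, map_mul, ← hf x, ← hf y]
    group

variable [Group.FG Γ]

theorem PolySeparated.exists_char {n : ℕ} (h : PolySeparated Γ n) :
    ∃ M : FiniteIndexNormalSubgroup Γ, M.toSubgroup.Characteristic ∧
      ∀ x ∈ M.toSubgroup, transRep Γ n x = 1 → x = 1 := by
  obtain ⟨H, hH, hs⟩ := h
  refine ⟨charCore ⟨H.normalCore, inferInstance, inferInstance⟩, inferInstance, fun x hx hx1 => ?_⟩
  refine hs x ?_ (transRep_eq_one_iff.mp hx1)
  exact H.normalCore_le (charCore_le (⟨H.normalCore, inferInstance, inferInstance⟩ : FiniteIndexNormalSubgroup Γ) hx)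

/-- In the kernel of `Aut(Γ) → Aut(Γ*)`, every subgroup of finite index induced from `Aut(Γ)`
is a congruence subgroup. -/
theorem exists_congruence_le {n : ℕ} (h : PolySeparated Γ n) (N : Subgroup (MulAut Γ)) [N.Normal]
    [N.FiniteIndex] : ∃ M : FiniteIndexNormalSubgroup Γ, ∀ φ : MulAut Γ, starAut Γ φ = 1 →
      (∀ x, x⁻¹ * φ x ∈ M.toSubgroup) → φ ∈ N := by
  obtain ⟨M₁, hchar, hM₁⟩ := h.exists_char
  obtain ⟨m, hm, H⟩ := (endFiltration Γ n).approx_ker (autRep Γ n) (X := (starAut Γ).ker)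
    (fun φ hφ => autRep_mem_U hφ) (N ⊓ (quotientAut M₁.toSubgroup).ker)
    ⟨_, Nat.pos_of_ne_zero Subgroup.FiniteIndex.index_ne_zero, fun g _ => Subgroup.pow_index_mem _ g⟩
  have := finiteIndex_congruenceUnits (R := filteredEnd Γ n) hm
  refine ⟨M₁ ⊓ FiniteIndexNormalSubgroup.comap (transRep Γ n)
    ⟨congruenceUnits (filteredEnd Γ n) m, inferInstance, inferInstance⟩, fun φ hφ hM => ?_⟩
  obtain ⟨ν, hν, hκ⟩ := H φ hφ (autRep_mem_congruenceUnits hm fun x => (hM x).2)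
  have hφ₁ : φ ∈ (quotientAut M₁.toSubgroup).ker := mem_ker_quotientAut.mpr fun x => (hM x).1
  have hκ₁ := mem_ker_quotientAut.mp (mul_mem (inv_mem hν.2) hφ₁)
  -- ν⁻¹φ acts trivially on polynomial functions, hence fixes all translations, and moves each x
  -- only within x·M₁; translation is faithful on M₁.
  have : ν⁻¹ * φ = 1 := by
    refine MulEquiv.ext fun x => ?_
    have h1 : transRep Γ n ((ν⁻¹ * φ) x) = transRep Γ n x := by
      rw [← autRep_conj, MonoidHom.mem_ker.mp hκ.2, one_mul, inv_one, mul_one]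
    have := hM₁ _ (hκ₁ x) (by rw [map_mul, map_inv, h1, inv_mul_cancel])
    exact (inv_mul_eq_one.mp this).symm
  rw [inv_mul_eq_one] at this
  exact this ▸ hν.1

/-- Homomorphisms Γ → ℤ are polynomial of degree less than 2, so all of them kill z; they separate
the points of the free group Γ*. This is where n ≥ 2 is needed. -/
theorem toStar_eq_one_of_transRep_mem {n : ℕ} (hn : 2 ≤ n) {z : Γ}
    (hz : transRep Γ n z ∈ (endFiltration Γ n).U 2) : toStar Γ z = 1 := by
  have hhom : ∀ B : Star Γ →* Multiplicative ℤ, B (toStar Γ z) = 1 := by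
    intro B
    let f : Γ → ℤ := fun g => (B (toStar Γ g)).toAdd
    have hf : f ∈ polyFun Γ 2 := by
      refine mem_polyFun_succ.mpr fun x => mem_polyFun_succ.mpr fun y => ?_
      rw [mem_polyFun_zero]
      funext g
      simp [f]
    have := hz 0 ⟨f, polyFun_mono hn hf⟩ hf
    have := congrFun (mem_polyFun_zero.mp this) 1
    have h2 : f (1 * z) - f 1 = 0 := this
    rw [sub_eq_zero, one_mul] at h2
    have h3 : f 1 = 0 := by simp [f]
    exact h2.trans h3
  have hfin : Module.Finite ℤ (Additive (Star Γ)) :=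
    Module.Finite.iff_addGroup_fg.mpr (AddGroup.fg_iff_mul_fg.mpr inferInstance)
  have : Module.Free ℤ (Additive (Star Γ)) := Module.free_of_finite_type_torsion_free'
  refine (Module.forall_dual_apply_eq_zero_iff ℤ (Additive.ofMul (toStar Γ z))).mp fun B => ?_
  exact hhom (AddMonoidHom.toMultiplicativeRight B.toAddMonoidHom)

/-- The heart of surjectivity. The automorphism ψ is conjugation by κ⁻¹φ, with κ a unipotent element
normalizing the translations and close to φ. -/
theorem exists_aut_of_starCongr {n : ℕ} (hn : 2 ≤ n) (h : PolySeparated Γ n)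
    (M : FiniteIndexNormalSubgroup Γ) : ∃ m > 0, ∀ φ : MulAut Γ, StarCongr m φ →
      ∃ ψ : MulAut Γ, (∀ x, x⁻¹ * ψ x ∈ M.toSubgroup) ∧ starAut Γ ψ = starAut Γ φ := by
  obtain ⟨M₁, -, hM₁⟩ := h.exists_char
  set M₂ : Subgroup Γ := (M ⊓ M₁).toSubgroup
  have hM₂ : ∀ x ∈ M₂, transRep Γ n x = 1 → x = 1 := fun x hx => hM₁ x hx.2
  let F := endFiltration Γ n
  set Λ : Subgroup (filteredEnd Γ n)ˣ := (transRep Γ n).range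
  have hΛ : Λ ≤ F.U 1 := by
    rintro _ ⟨x, rfl⟩
    exact transRep_mem_U x
  -- A translation of congruence level m' is the translation by some element of M₂.
  obtain ⟨m', hm', H'⟩ := F.approx_ker (transRep Γ n) (X := ⊤) (fun x _ => transRep_mem_U x) M₂
    ⟨_, Nat.pos_of_ne_zero Subgroup.FiniteIndex.index_ne_zero, fun g _ => Subgroup.pow_index_mem _ g⟩
  obtain ⟨m'', hm'', H''⟩ := F.exists_mem_normalizer hΛ hm'
  -- The factor m'' allows passing from k to κ, and m' makes κ⁻¹φ = (κ⁻¹k)(φ⁻¹k)⁻¹ of level m'.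
  obtain ⟨m, hm, H⟩ := exists_unipotent_congr Γ n (Nat.mul_pos hm'' hm')
  refine ⟨m, hm, fun φ hφ => ?_⟩
  have hφΛ : autRep Γ n φ ∈ Subgroup.normalizer (Λ : Set (filteredEnd Γ n)ˣ) := by
    refine Subgroup.mem_normalizer_iff.mpr fun g => ⟨?_, ?_⟩
    · rintro ⟨x, rfl⟩
      exact ⟨φ x, (autRep_conj φ x).symm⟩
    · rintro ⟨x, hx⟩
      refine ⟨φ⁻¹ x, ?_⟩
      rw [← autRep_conj, hx, map_inv]
      group
  obtain ⟨k, hk, hφk⟩ := H φ hφ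
  obtain ⟨κ, hκ, hκΛ, hκk⟩ := H'' k hk _ hφΛ (congruenceUnits_anti (dvd_mul_right _ _) hφk)
  set ψ := κ⁻¹ * autRep Γ n φ
  have hψΛ : ψ ∈ Subgroup.normalizer (Λ : Set (filteredEnd Γ n)ˣ) := mul_mem (inv_mem hκΛ) hφΛ
  have hψC : ψ ∈ congruenceUnits (filteredEnd Γ n) m' := by
    have := mul_mem hκk (inv_mem (congruenceUnits_anti (dvd_mul_left _ _) hφk))
    rwa [mul_inv_rev, inv_inv, mul_assoc, mul_inv_cancel_left] at this
  have key : ∀ ψ ∈ Subgroup.normalizer (Λ : Set (filteredEnd Γ n)ˣ),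
      ψ ∈ congruenceUnits (filteredEnd Γ n) m' →
      ∀ x, ∃ y, ψ * transRep Γ n x * ψ⁻¹ = transRep Γ n y ∧ x⁻¹ * y ∈ M₂ := by
    intro ψ hψ hψC x
    obtain ⟨y, hy⟩ := (Subgroup.mem_normalizer_iff.mp hψ _).mp ⟨x, rfl⟩
    have hC : transRep Γ n (x⁻¹ * y) ∈ congruenceUnits (filteredEnd Γ n) m' := by
      rw [map_mul, hy, map_inv, ← mul_assoc]
      refine mul_mem ?_ (inv_mem hψC)
      have := (congruenceUnits_normal m').conj_mem _ hψC (transRep Γ n x)⁻¹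
      rwa [inv_inv, mul_assoc] at this
    obtain ⟨ν, hν, hk⟩ := H' (x⁻¹ * y) trivial hC
    have hk' : transRep Γ n ν = transRep Γ n (x⁻¹ * y) := by
      have := MonoidHom.mem_ker.mp hk.2
      rwa [map_mul, map_inv, inv_mul_eq_one] at this
    refine ⟨x * ν, ?_, by rwa [inv_mul_cancel_left]⟩
    rw [map_mul, hk', ← map_mul, mul_inv_cancel_left, hy]
  obtain ⟨f, hf⟩ := exists_hom_of_conj hM₂ (key ψ hψΛ hψC)
  obtain ⟨f', hf'⟩ := exists_hom_of_conj hM₂ (key ψ⁻¹ (inv_mem hψΛ) (inv_mem hψC))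
  have hinv : ∀ (g g' : Γ →* Γ) (χ : (filteredEnd Γ n)ˣ),
      (∀ x, χ * transRep Γ n x * χ⁻¹ = transRep Γ n (g x) ∧ x⁻¹ * g x ∈ M₂) →
      (∀ x, χ⁻¹ * transRep Γ n x * χ⁻¹⁻¹ = transRep Γ n (g' x) ∧ x⁻¹ * g' x ∈ M₂) →
      ∀ x, g' (g x) = x := by
    intro g g' χ hg hg' x
    have h1 : transRep Γ n (g' (g x)) = transRep Γ n x := by
      rw [← (hg' (g x)).1, ← (hg x).1]; group
    have h2 : x⁻¹ * g' (g x) ∈ M₂ := by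
      have := mul_mem (hg x).2 (hg' (g x)).2
      rwa [mul_assoc, mul_inv_cancel_left] at this
    exact (inv_mul_eq_one.mp (hM₂ _ h2 (by rw [map_mul, map_inv, h1, inv_mul_cancel]))).symm
  let ψ' : MulAut Γ :=
    { toFun := f
      invFun := f'
      left_inv := hinv f f' ψ hf hf'
      right_inv := hinv f' f ψ⁻¹ hf' (by simpa using hf)
      map_mul' := map_mul f }
  refine ⟨ψ', fun x => (hf x).2.1, MulEquiv.ext fun y => ?_⟩
  obtain ⟨x, rfl⟩ := toStar_surjective Γ y
  rw [starAut_toStar, starAut_toStar]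
  -- The discrepancy between φ and ψ is the commutator of two elements of U(1), hence lies in U(2)
  -- and vanishes in Γ*.
  have h1 : transRep Γ n (φ x * (f x)⁻¹) =
      κ * transRep Γ n (f x) * κ⁻¹ * (transRep Γ n (f x))⁻¹ := by
    rw [map_mul, map_inv, ← autRep_conj, ← (hf x).1]
    simp only [ψ]
    group
  have h2 := toStar_eq_one_of_transRep_mem hn
    (h1 ▸ F.commutator_mem hκ (transRep_mem_U (f x)))
  rw [map_mul, map_inv, mul_inv_eq_one] at h2
  exact h2.symm

end Congruence

/-! ### Weighted degrees for extending polynomials from a normal subgroup -/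

section WeightedPolynomials

variable {G : Type u} [Group G]

/-- Functions which are invariant under left translation by `t` and polynomial of weighted degree
less than `D`, where differences by elements of `N i` have weight `i + 1`. -/
def weightedFun (N : ℕ → Subgroup G) (t : G) : ℕ → Submodule ℤ (G → ℤ)
  | 0 => ⊥
  | D + 1 => LinearMap.ker (LinearMap.funLeft ℤ ℤ (t * ·) - LinearMap.id) ⊓
      ⨅ i : ℕ, ⨅ x : N i, (weightedFun N t (D - i)).comap (translate (x : G) - LinearMap.id)
  termination_by D => D

variable {N : ℕ → Subgroup G} {t : G}

theorem mem_weightedFun_zero {p : G → ℤ} : p ∈ weightedFun N t 0 ↔ p = 0 := by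
  rw [weightedFun]; exact Submodule.mem_bot _

theorem mem_weightedFun_succ {D : ℕ} {p : G → ℤ} : p ∈ weightedFun N t (D + 1) ↔
    (∀ g, p (t * g) = p g) ∧
      ∀ i, ∀ x ∈ N i, translate x p - p ∈ weightedFun N t (D - i) := by
  rw [weightedFun]
  simp only [Submodule.mem_inf, Submodule.mem_iInf, Submodule.mem_comap, LinearMap.mem_ker,
    LinearMap.sub_apply, LinearMap.id_apply, sub_eq_zero, funext_iff, Subtype.forall]
  rfl

theorem weightedFun_le_succ (D : ℕ) : weightedFun N t D ≤ weightedFun N t (D + 1) := by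
  induction D using Nat.strong_induction_on with
  | _ D ih =>
    intro p hp
    cases D with
    | zero => rw [mem_weightedFun_zero.mp hp]; exact zero_mem _
    | succ D =>
      obtain ⟨h1, h2⟩ := mem_weightedFun_succ.mp hp
      refine mem_weightedFun_succ.mpr ⟨h1, fun i x hx => ?_⟩
      by_cases hi : i ≤ D
      · rw [Nat.succ_sub hi]
        exact ih (D - i) (by omega) (h2 i x hx)
      · have := h2 i x hx
        rw [show D - i = 0 by omega] at this
        rwa [show D + 1 - i = 0 by omega]

theorem weightedFun_mono : Monotone (weightedFun N t) := monotone_nat_of_le_succ weightedFun_le_succ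

theorem translate_mem_weightedFun (hN : ∀ i, (N i).Normal) {D : ℕ} (g : G) {p : G → ℤ}
    (hp : p ∈ weightedFun N t D) : translate g p ∈ weightedFun N t D := by
  induction D using Nat.strong_induction_on generalizing p with
  | _ D ih =>
    cases D with
    | zero => rw [mem_weightedFun_zero] at hp ⊢; rw [hp, map_zero]
    | succ D =>
      obtain ⟨h1, h2⟩ := mem_weightedFun_succ.mp hp
      refine mem_weightedFun_succ.mpr ⟨fun h => ?_, fun i x hx => ?_⟩
      · rw [translate_apply, translate_apply, mul_assoc, h1]
      · have h3 : translate x (translate g p) - translate g p =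
            translate g (translate (g⁻¹ * x * g) p - p) := by
          rw [map_sub, ← translate_mul, ← translate_mul, mul_assoc, mul_inv_cancel_left]
        rw [h3]
        refine ih _ (by omega) (h2 i _ ?_)
        simpa using (hN i).conj_mem x hx g⁻¹

/-- Left invariance under t turns right translation by t into right translation by the commutator
g⁻¹t⁻¹gt in `N 0`, which settles the bottom degree. In general, moving t past x in `N i` costs an
element of `N (i + 1)`, whose extra weight pays for the loss of degree. -/
theorem translate_sub_mem_weightedFun (hN : ∀ i, (N i).Normal)
    (hcomm : ∀ x y : G, x⁻¹ * y⁻¹ * x * y ∈ N 0)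
    (ht : ∀ i, ∀ x ∈ N i, x⁻¹ * t⁻¹ * x * t ∈ N (i + 1)) {D : ℕ} {p : G → ℤ}
    (hp : p ∈ weightedFun N t (D + 1)) : translate t p - p ∈ weightedFun N t D := by
  induction D using Nat.strong_induction_on generalizing p with
  | _ D ih =>
    obtain ⟨h1, h2⟩ := mem_weightedFun_succ.mp hp
    cases D with
    | zero =>
      rw [mem_weightedFun_zero]
      funext g
      have h3 := congrFun (mem_weightedFun_zero.mp (h2 0 _ (hcomm g t))) (t * g)
      have h4 : t * g * (g⁻¹ * t⁻¹ * g * t) = g * t := by group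
      simp only [Pi.sub_apply, translate_apply, h4, h1] at h3
      exact h3
    | succ D =>
      refine mem_weightedFun_succ.mpr ⟨fun g => ?_, fun i x hx => ?_⟩
      · simp only [Pi.sub_apply, translate_apply, mul_assoc, h1]
      · have h3 : translate x (translate t p - p) - (translate t p - p) =
            (translate t (translate x p - p) - (translate x p - p)) +
              translate t (translate x (translate (x⁻¹ * t⁻¹ * x * t) p - p)) := by
          have h4 : t * (x * (x⁻¹ * t⁻¹ * x * t)) = x * t := by group
          simp only [map_sub, ← translate_mul, h4]
          abel
        rw [h3]
        refine add_mem ?_ (translate_mem_weightedFun hN _ (translate_mem_weightedFun hN _ ?_))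
        · by_cases hi : i ≤ D
          · refine ih (D - i) (by omega) ?_
            have := h2 i x hx
            rwa [Nat.succ_sub hi] at this
          · have := h2 i x hx
            rw [show D + 1 - i = 0 by omega, mem_weightedFun_zero] at this
            rw [this, map_zero, sub_zero]
            exact zero_mem _
        · have := h2 (i + 1) _ (ht i x hx)
          rwa [Nat.add_sub_add_right] at this

/-- The elements whose differences lower the weighted degree form a subgroup; it contains `N 0` and
t, hence is everything. -/
theorem weightedFun_le_polyFun (hN : ∀ i, (N i).Normal)
    (hcomm : ∀ x y : G, x⁻¹ * y⁻¹ * x * y ∈ N 0)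
    (ht : ∀ i, ∀ x ∈ N i, x⁻¹ * t⁻¹ * x * t ∈ N (i + 1))
    (htop : N 0 ⊔ Subgroup.zpowers t = ⊤) (D : ℕ) : weightedFun N t D ≤ polyFun G D := by
  let K : Subgroup G :=
    { carrier := {g | ∀ D, ∀ p ∈ weightedFun N t (D + 1), translate g p - p ∈ weightedFun N t D}
      one_mem' := fun D p _ => by rw [translate_one, sub_self]; exact zero_mem _
      mul_mem' := fun {x y} hx hy D p hp => by
        have : translate (x * y) p - p =
            translate x (translate y p - p) + (translate x p - p) := by
          rw [translate_mul, map_sub]; abel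
        rw [this]
        exact add_mem (translate_mem_weightedFun hN _ (hy D p hp)) (hx D p hp)
      inv_mem' := fun {x} hx D p hp => by
        have : translate x⁻¹ p - p = - translate x⁻¹ (translate x p - p) := by
          rw [map_sub, ← translate_mul, inv_mul_cancel, translate_one, neg_sub]
        rw [this]
        exact neg_mem (translate_mem_weightedFun hN _ (hx D p hp)) }
  have hK : K = ⊤ := by
    rw [eq_top_iff, ← htop, sup_le_iff, Subgroup.zpowers_le]
    exact ⟨fun x hx D p hp => (mem_weightedFun_succ.mp hp).2 0 x hx, fun D p hp =>
      translate_sub_mem_weightedFun hN hcomm ht hp⟩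
  induction D with
  | zero => exact fun p hp => mem_polyFun_zero.mpr (mem_weightedFun_zero.mp hp)
  | succ D ih =>
    refine fun p hp => mem_polyFun_succ.mpr fun x => ih ?_
    have hx : x ∈ K := hK ▸ Subgroup.mem_top x
    exact hx D p hp

end WeightedPolynomials

/-! ### Separating points through extensions by subgroups of ℤ -/

section Separation

variable {G : Type u} [Group G]

/-- The image of f is cyclic and torsion-free, so G is a semidirect product of ker f and the cyclic
group of a lift t of a generator, with projection s. For trivial f, take t = 1. -/
theorem exists_retraction (f : G →* Multiplicative ℤ) : ∃ (t : G) (s : G →* G),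
    (∀ g, s g ∈ Subgroup.zpowers t) ∧ s t = t ∧ (∀ x ∈ f.ker, s x = 1) ∧
      ∀ g, (s g)⁻¹ * g ∈ f.ker := by
  obtain ⟨⟨_, t, rfl⟩, ht⟩ := IsCyclic.exists_generator (α := f.range)
  have hgen : ∀ g, ∃ k : ℤ, (f t) ^ k = f g := fun g => by
    obtain ⟨k, hk⟩ := ht ⟨f g, g, rfl⟩
    exact ⟨k, congrArg Subtype.val hk⟩
  by_cases h : f t = 1
  · refine ⟨1, 1, fun g => one_mem _, rfl, fun _ _ => rfl, fun g => ?_⟩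
    obtain ⟨k, hk⟩ := hgen g
    rw [h, one_zpow] at hk
    simpa using hk.symm
  · choose k hk using hgen
    have hinj : ∀ a b : ℤ, f t ^ a = f t ^ b → a = b := by
      intro a b hab
      have h1 : a * (f t).toAdd = b * (f t).toAdd := congrArg Multiplicative.toAdd hab
      exact mul_right_cancel₀ (fun h0 => h h0) h1
    refine ⟨t, (zpowersHom G t).comp (MonoidHom.mk' (fun g => Multiplicative.ofAdd (k g))
      fun a b => ?_), fun g => ⟨k g, rfl⟩, ?_, fun x hx => ?_, fun g => ?_⟩
    · rw [← ofAdd_add]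
      refine congrArg _ (hinj _ _ ?_)
      rw [hk, zpow_add, hk, hk, map_mul]
    · change t ^ k t = t
      rw [hinj (k t) 1 (by rw [hk, zpow_one]), zpow_one]
    · change t ^ k x = 1
      rw [hinj (k x) 0 (by rw [hk, zpow_zero]; exact hx), zpow_zero]
    · change f ((t ^ k g)⁻¹ * g) = 1
      rw [map_mul, map_inv, map_zpow, hk, inv_mul_cancel]

/-- Polynomials on ker f are pulled back along g ↦ s(g)⁻¹g. Nilpotency of G makes the pullbacks
polynomial, and with f itself they separate the points of M·⟨t⟩. -/
theorem PolySeparated.of_ker [Group.IsNilpotent G] (f : G →* Multiplicative ℤ) [Group.FG f.ker]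
    {n : ℕ} (h : PolySeparated f.ker n) : ∃ m, PolySeparated G m := by
  obtain ⟨t, s, hs, hst, hs1, hsf⟩ := exists_retraction f
  obtain ⟨M, hchar, hM⟩ := h.exists_char
  obtain ⟨c, hc⟩ := Subgroup.nilpotent_iff_lowerCentralSeries.mp ‹Group.IsNilpotent G›
  have hker : ∀ g, g * (s g)⁻¹ ∈ f.ker := fun g => by
    have := hsf g
    rw [MonoidHom.mem_ker] at this ⊢
    rw [map_mul] at this ⊢
    rw [mul_comm, this]
  let N : ℕ → Subgroup G := fun i => f.ker ⊓ (⊤ : Subgroup G).lowerCentralSeries i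
  have hN : ∀ i, (N i).Normal := fun i => inferInstance
  have hN0 : N 0 = f.ker := inf_top_eq _
  have hcomm : ∀ x y : G, x⁻¹ * y⁻¹ * x * y ∈ N 0 := by
    intro x y
    rw [hN0, MonoidHom.mem_ker]
    simp only [map_mul, map_inv]
    rw [mul_right_comm (f x)⁻¹, inv_mul_cancel, one_mul, inv_mul_cancel]
  have hNt : ∀ i, ∀ x ∈ N i, x⁻¹ * t⁻¹ * x * t ∈ N (i + 1) := by
    intro i x hx
    refine ⟨hN0 ▸ hcomm x t, ?_⟩
    rw [Subgroup.lowerCentralSeries_succ]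
    have := Subgroup.commutator_mem_commutator (inv_mem hx.2) (Subgroup.mem_top t⁻¹)
    rwa [commutatorElement_def, inv_inv, inv_inv] at this
  have htop : N 0 ⊔ Subgroup.zpowers t = ⊤ := by
    refine eq_top_iff.mpr fun g _ => ?_
    rw [hN0]
    have := Subgroup.mul_mem_sup (hker g) (hs g)
    rwa [inv_mul_cancel_right] at this
  let ext : (f.ker → ℤ) → G → ℤ := fun p g => p ⟨(s g)⁻¹ * g, hsf g⟩
  have hext : ∀ p (x : f.ker), translate (x : G) (ext p) = ext (translate x p) := by
    intro p x
    funext g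
    refine congrArg p (Subtype.ext ?_)
    change (s (g * x))⁻¹ * (g * x) = (s g)⁻¹ * g * x
    rw [map_mul, hs1 _ x.2, mul_one, mul_assoc]
  -- Each ordinary degree costs c + 1 weights: a nontrivial element of `N i` has i ≤ c, so its
  -- difference has weight at most c + 1.
  have hW : ∀ (n : ℕ) (p : f.ker → ℤ), p ∈ polyFun f.ker n →
      ext p ∈ weightedFun N t ((c + 1) * n) := by
    intro n
    induction n with
    | zero =>
      intro p hp
      rw [mem_polyFun_zero] at hp
      rw [mul_zero, mem_weightedFun_zero, hp]
      rfl
    | succ n ih =>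
      intro p hp
      rw [mul_add, mul_one, ← add_assoc]
      refine mem_weightedFun_succ.mpr ⟨fun g => ?_, fun i x hx => ?_⟩
      · refine congrArg p (Subtype.ext ?_)
        change (s (t * g))⁻¹ * (t * g) = (s g)⁻¹ * g
        rw [map_mul, hst]
        group
      · by_cases hi : i ≤ c
        · have := ih _ (mem_polyFun_succ.mp hp ⟨x, hx.1⟩)
          refine weightedFun_mono (show (c + 1) * n ≤ (c + 1) * n + c - i by omega) ?_
          rw [hext p ⟨x, hx.1⟩]
          exact this
        · have hx1 : x = 1 := by
            have := Subgroup.lowerCentralSeries_antitone _ (not_le.mp hi).le hx.2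
            rwa [hc, Subgroup.mem_bot] at this
          rw [hx1, translate_one, sub_self]
          exact zero_mem _
  have hnorm : (M.toSubgroup.map f.ker.subtype).Normal := inferInstance
  set H : Subgroup G := M.toSubgroup.map f.ker.subtype ⊔ Subgroup.zpowers t
  have hHN : ∀ x ∈ H, ∀ hx : x ∈ f.ker, (⟨x, hx⟩ : f.ker) ∈ M.toSubgroup := by
    intro x hxH hx
    obtain ⟨_, ⟨y, hy, rfl⟩, z, hz, rfl⟩ := Subgroup.mem_sup_of_normal_left.mp hxH
    have hz1 : z ∈ f.ker := by
      have := mul_mem (inv_mem y.2) hx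
      rwa [Subgroup.coe_subtype, inv_mul_cancel_left] at this
    have hz2 : z = 1 := by
      obtain ⟨k, rfl⟩ := hz
      have := hs1 _ hz1
      beta_reduce at this ⊢
      rwa [map_zpow, hst] at this
    subst hz2
    have : (⟨f.ker.subtype y * 1, hx⟩ : f.ker) = y := Subtype.ext (mul_one (y : G))
    rwa [this]
  have hfin : H.FiniteIndex := by
    have : Finite (f.ker ⧸ M.toSubgroup) := Subgroup.finite_quotient_of_finiteIndex
    have : Finite (G ⧸ H) := by
      let F : f.ker ⧸ M.toSubgroup → G ⧸ H := Quotient.map' (fun x : f.ker => (x : G))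
        fun x y hxy => by
          rw [QuotientGroup.leftRel_apply] at hxy ⊢
          exact Subgroup.mem_sup_left ⟨_, hxy, rfl⟩
      refine Finite.of_surjective F fun q => ?_
      obtain ⟨g, rfl⟩ := QuotientGroup.mk_surjective q
      refine ⟨QuotientGroup.mk ⟨_, hker g⟩, QuotientGroup.eq.mpr ?_⟩
      have : (g * (s g)⁻¹)⁻¹ * g = s g := by group
      rw [this]
      exact Subgroup.mem_sup_right (hs g)
    exact Subgroup.finiteIndex_of_finite_quotient
  -- Degree less than 2 includes f, which forces x into ker f.
  refine ⟨max 2 ((c + 1) * n), H, hfin, fun x hxH hx => ?_⟩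
  have hxf : x ∈ f.ker := by
    let a : G → ℤ := fun g => (f g).toAdd
    have ha : a ∈ polyFun G 2 := by
      refine mem_polyFun_succ.mpr fun x => mem_polyFun_succ.mpr fun y => ?_
      rw [mem_polyFun_zero]
      funext g
      simp [a]
    have := congrFun (hx a (polyFun_mono (le_max_left _ _) ha)) 1
    have h2 : (f (1 * x)).toAdd = (f 1).toAdd := this
    rw [one_mul, map_one] at h2
    exact h2
  refine congrArg Subtype.val (hM ⟨x, hxf⟩ (hHN x hxH hxf) (transRep_eq_one_iff.mpr fun p hp => ?_))
  have h1 := hx (ext p) (polyFun_mono (le_max_right _ _)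
    (weightedFun_le_polyFun hN hcomm hNt htop _ (hW n p hp)))
  rw [hext p ⟨x, hxf⟩] at h1
  funext y
  have h2 := congrFun h1 y
  have h3 : (⟨(s (y : G))⁻¹ * y, hsf y⟩ : f.ker) = y := Subtype.ext (by
    change (s (y : G))⁻¹ * (y : G) = y
    rw [hs1 _ y.2, inv_one, one_mul])
  change translate (⟨x, hxf⟩ : f.ker) p ⟨(s (y : G))⁻¹ * y, hsf y⟩ =
    p ⟨(s (y : G))⁻¹ * y, hsf y⟩ at h2
  rwa [h3] at h2

end Separation

/-! ### Finitely generated nilpotent groups as iterated extensions -/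

open scoped commutatorElement

/-- The groups obtained from finite groups by successive extensions of subgroups of `ℤ`. -/
inductive PolyInfiniteCyclicByFinite : (G : Type u) → [Group G] → Prop
  | of_finite (G : Type u) [Group G] [Finite G] : PolyInfiniteCyclicByFinite G
  | of_ker (G : Type u) [Group G] (f : G →* Multiplicative ℤ)
      (h : PolyInfiniteCyclicByFinite f.ker) : PolyInfiniteCyclicByFinite G

namespace PolyInfiniteCyclicByFinite

theorem fg {G : Type u} [Group G] (h : PolyInfiniteCyclicByFinite G) : Group.FG G := by
  induction h with
  | of_finite G => infer_instance
  | of_ker G f h ih => exact fg_of_ker_commGroup f ih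

theorem polySeparated {G : Type u} [Group G] (h : PolyInfiniteCyclicByFinite G)
    (hG : Group.IsNilpotent G) : ∃ n, PolySeparated G n := by
  induction h with
  | of_finite G => exact ⟨0, ⊥, inferInstance, fun x hx _ => hx⟩
  | of_ker G f h ih =>
    obtain ⟨n, hn⟩ := ih inferInstance
    have := h.fg
    exact hn.of_ker f

theorem of_pi (r : ℕ) {G : Type u} [Group G] (g : G →* (Fin r → Multiplicative ℤ))
    (hg : Finite g.ker) : PolyInfiniteCyclicByFinite G := by
  induction r generalizing G with
  | zero =>
    have : Finite G := g.finite_iff_finite_ker_range.mpr ⟨hg, inferInstance⟩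
    exact of_finite G
  | succ r ih =>
    let f : G →* Multiplicative ℤ := (Pi.evalMonoidHom _ 0).comp g
    refine of_ker G f (ih (MonoidHom.pi fun i => ((Pi.evalMonoidHom _ i.succ).comp g).comp
      f.ker.subtype) ?_)
    refine Finite.of_injective (β := g.ker) (fun x => ⟨x.1.1, ?_⟩) fun x y h =>
      Subtype.ext (Subtype.ext (Subtype.mk.inj h))
    funext i
    refine Fin.cases ?_ (fun i => ?_) i
    · exact x.1.2
    · exact congrFun x.2 i

theorem of_commGroup {G : Type u} [Group G] {W : Type*} [CommGroup W] [Group.FG W] (h : G →* W)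
    (hker : Finite h.ker) : PolyInfiniteCyclicByFinite G := by
  have hfg : Group.FG (W ⧸ CommGroup.torsion W) := inferInstance
  have : Module.Finite ℤ (Additive (W ⧸ CommGroup.torsion W)) :=
    Module.Finite.iff_addGroup_fg.mpr (AddGroup.fg_iff_mul_fg.mpr hfg)
  have : Module.Free ℤ (Additive (W ⧸ CommGroup.torsion W)) :=
    Module.free_of_finite_type_torsion_free'
  let e := (Module.finBasis ℤ (Additive (W ⧸ CommGroup.torsion W))).equivFun
  let q : G →* W ⧸ CommGroup.torsion W := (QuotientGroup.mk' _).comp h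
  let g : G →* (Fin _ → Multiplicative ℤ) := MonoidHom.mk'
    (fun x i => Multiplicative.ofAdd (e (Additive.ofMul (q x)) i)) fun x y => by
      funext i
      rw [map_mul, ofMul_mul, map_add]
      rfl
  refine of_pi _ g ?_
  have htor : Finite (CommGroup.torsion W) := by
    have := fg_subgroup_commGroup (CommGroup.torsion W)
    have hM : Module.Finite ℤ (Additive (CommGroup.torsion W)) :=
      Module.Finite.iff_addGroup_fg.mpr (AddGroup.fg_iff_mul_fg.mpr this)
    have : Finite (Additive (CommGroup.torsion W)) := by
      refine Module.finite_of_fg_torsion _ fun {x} => ?_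
      obtain ⟨k, hk, hk1⟩ := isOfFinOrder_iff_pow_eq_one.mp x.toMul.2
      refine ⟨⟨(k : ℤ), mem_nonZeroDivisors_of_ne_zero (Int.natCast_ne_zero.mpr hk.ne')⟩, ?_⟩
      change (k : ℤ) • x = 0
      rw [natCast_zsmul]
      exact Subtype.ext hk1
    exact this
  have hgq : ∀ x ∈ g.ker, h x ∈ CommGroup.torsion W := by
    intro x hx
    refine (QuotientGroup.eq_one_iff _).mp ?_
    have : e (Additive.ofMul (q x)) = 0 := funext fun i => congrFun hx i
    exact e.map_eq_zero_iff.mp this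
  refine ((h.comp g.ker.subtype).codRestrict _ fun x => hgq x x.2).finite_iff_finite_ker_range.mpr
    ⟨?_, inferInstance⟩
  exact Finite.of_injective (β := h.ker) (fun x => ⟨x.1.1, congrArg Subtype.val x.2⟩) fun x y h =>
    Subtype.ext (Subtype.ext (Subtype.mk.inj h))

/-- The transfer to the centre is x ↦ x ^ index. Its kernel has finite exponent and meets the centre
in a finitely generated torsion abelian group, so it is finite. -/
theorem of_finiteIndex_center {G : Type u} [Group G] [Group.FG G]
    [(Subgroup.center G).FiniteIndex] : PolyInfiniteCyclicByFinite G := by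
  have hfg : Group.FG (Subgroup.center G) := Subgroup.fg_of_index_ne_zero _
  let inst : CommGroup (Subgroup.center G) :=
    { (inferInstance : Group (Subgroup.center G)) with
      mul_comm := fun a b => Subtype.ext (Subgroup.mem_center_iff.mp b.2 a) }
  refine of_commGroup (W := Subgroup.center G) (MonoidHom.transferCenterPow G) ?_
  set E := (MonoidHom.transferCenterPow G).ker
  have hpow : ∀ x ∈ E, x ^ (Subgroup.center G).index = 1 := fun x hx => by
    rw [← MonoidHom.transferCenterPow_apply, MonoidHom.mem_ker.mp hx]; rfl
  have hquot : Finite (G ⧸ Subgroup.center G) := Subgroup.finite_quotient_of_finiteIndex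
  refine ((QuotientGroup.mk' (Subgroup.center G)).comp E.subtype).finite_iff_finite_ker_range.mpr
    ⟨?_, inferInstance⟩
  set K := ((QuotientGroup.mk' (Subgroup.center G)).comp E.subtype).ker
  have hK : ∀ x : K, (x : G) ∈ Subgroup.center G := fun x => (QuotientGroup.eq_one_iff _).mp x.2
  let ι : K →* Subgroup.center G := (E.subtype.comp K.subtype).codRestrict _ hK
  have hι : Function.Injective ι := fun x y h => Subtype.ext (Subtype.ext (Subtype.mk.inj h))
  have := fg_subgroup_commGroup ι.range
  have hfin : Finite ι.range := by
    refine CommGroup.finite_of_fg_isMulTorsion _ ?_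
    rintro ⟨_, x, rfl⟩
    refine isOfFinOrder_iff_pow_eq_one.mpr ⟨_, Nat.pos_of_ne_zero
      (Subgroup.FiniteIndex.index_ne_zero (H := Subgroup.center G)), ?_⟩
    exact Subtype.ext (Subtype.ext (hpow x x.1.2))
  exact Finite.of_injective ι.rangeRestrict fun x y h => hι (congrArg Subtype.val h)

/-- The homomorphisms to ℤ pull back from Q to G, leaving a central extension of a finite group,
whose centre has finite index. -/
theorem of_central_extension {Q : Type u} [Group Q] (hQ : PolyInfiniteCyclicByFinite Q)
    {G : Type u} [Group G] (π : G →* Q) (hπ : π.ker ≤ Subgroup.center G) (hfg : Group.FG π.ker) :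
    PolyInfiniteCyclicByFinite G := by
  induction hQ generalizing G with
  | of_finite Q =>
    have : Group.FG G := fg_of_ker_range π
    have : π.ker.FiniteIndex := inferInstance
    have : (Subgroup.center G).FiniteIndex := Subgroup.finiteIndex_of_le hπ
    exact of_finiteIndex_center
  | of_ker Q f h ih =>
    refine of_ker G (f.comp π) (ih ((π.comp (f.comp π).ker.subtype).codRestrict _
      fun x => x.2) ?_ ?_)
    · intro x hx
      refine Subgroup.mem_center_iff.mpr fun y => Subtype.ext ?_
      exact Subgroup.mem_center_iff.mp (hπ (congrArg Subtype.val hx : π x = 1)) y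
    · have hle : ∀ x : π.ker, (x : G) ∈ (f.comp π).ker := fun x => by
        rw [MonoidHom.mem_ker, MonoidHom.comp_apply, MonoidHom.mem_ker.mp x.2, map_one]
      refine Group.fg_of_surjective (f := (π.ker.subtype.codRestrict _ hle).codRestrict _
        fun x => Subtype.ext x.2) ?_
      rintro ⟨⟨x, hx⟩, hx'⟩
      exact ⟨⟨x, congrArg Subtype.val hx'⟩, rfl⟩

end PolyInfiniteCyclicByFinite

/-- Modulo the next term, the commutators of generators of one term with generators of G suffice: in
the quotient by them the earlier term becomes central. -/
theorem exists_finite_lowerCentralSeries_le {G : Type u} [Group G] [Group.FG G] (i : ℕ) :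
    ∃ T : Set G, T.Finite ∧ T ⊆ (⊤ : Subgroup G).lowerCentralSeries i ∧
      (⊤ : Subgroup G).lowerCentralSeries i ≤
        Subgroup.closure T ⊔ (⊤ : Subgroup G).lowerCentralSeries (i + 1) := by
  obtain ⟨S, hS, hSf⟩ := Group.fg_iff.mp ‹Group.FG G›
  set γ := (⊤ : Subgroup G).lowerCentralSeries
  induction i with
  | zero => exact ⟨S, hSf, fun _ _ => trivial, by rw [hS]; exact le_sup_left.trans' le_top⟩
  | succ i ih =>
    obtain ⟨T, hTf, hT, hγ⟩ := ih
    have hcomm : ∀ j, ∀ x ∈ γ j, ∀ y, ⁅x, y⁆ ∈ γ (j + 1) := fun j x hx y => by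
      change ⁅x, y⁆ ∈ (⊤ : Subgroup G).lowerCentralSeries (j + 1)
      rw [Subgroup.lowerCentralSeries_succ]
      exact Subgroup.commutator_mem_commutator hx (Subgroup.mem_top y)
    have hT' : Set.image2 (fun x y => ⁅x, y⁆) T S ⊆ γ (i + 1) := by
      rintro _ ⟨x, hx, y, _, rfl⟩
      exact hcomm i x (hT hx) y
    refine ⟨Set.image2 (fun x y => ⁅x, y⁆) T S, hTf.image2 _ hSf, hT', ?_⟩
    set L := Subgroup.closure (Set.image2 (fun x y => ⁅x, y⁆) T S) ⊔ γ (i + 2)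
    have hL : L ≤ γ (i + 1) := sup_le ((Subgroup.closure_le _).mpr hT')
      (Subgroup.lowerCentralSeries_antitone _ (Nat.le_succ _))
    have hn : L.Normal := ⟨fun x hx g => by
      have h1 : (⁅x, g⁆ : G)⁻¹ ∈ L :=
        inv_mem (Subgroup.mem_sup_right (hcomm (i + 1) x (hL hx) g))
      have := mul_mem h1 hx
      rwa [commutatorElement_inv, commutatorElement_def, inv_mul_cancel_right] at this⟩
    have hcent : ∀ x y : G, ⁅x, y⁆ ∈ L ↔ Commute (x : G ⧸ L) (y : G ⧸ L) := fun x y => by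
      rw [← commutatorElement_eq_one_iff_commute, ← QuotientGroup.eq_one_iff]
      rfl
    have hγ' : γ i ≤ (Subgroup.center (G ⧸ L)).comap (QuotientGroup.mk' L) := by
      refine hγ.trans (sup_le ((Subgroup.closure_le _).mpr fun x hx => ?_) fun x hx => ?_)
      · refine Subgroup.mem_center_iff.mpr fun y => ?_
        obtain ⟨y, rfl⟩ := QuotientGroup.mk_surjective y
        have hS' : Subgroup.closure S ≤
            (Subgroup.centralizer {(x : G ⧸ L)}).comap (QuotientGroup.mk' L) :=
          (Subgroup.closure_le _).mpr fun s hs => Subgroup.mem_centralizer_singleton_iff.mpr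
            ((hcent x s).mp (Subgroup.mem_sup_left (Subgroup.subset_closure
              ⟨x, hx, s, hs, rfl⟩))).symm
        rw [hS] at hS'
        exact Subgroup.mem_centralizer_singleton_iff.mp (hS' (Subgroup.mem_top y))
      · refine Subgroup.mem_center_iff.mpr fun y => ?_
        obtain ⟨y, rfl⟩ := QuotientGroup.mk_surjective y
        exact ((hcent x y).mp (Subgroup.mem_sup_right (hcomm (i + 1) x hx y))).symm
    change (⊤ : Subgroup G).lowerCentralSeries (i + 1) ≤ L
    rw [Subgroup.lowerCentralSeries_succ, Subgroup.commutator_le]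
    intro x hx y _
    exact (hcent x y).mpr (Subgroup.mem_center_iff.mp (hγ' hx) y).symm

theorem polyInfiniteCyclicByFinite_of_lowerCentralSeries (c : ℕ) {G : Type u} [Group G]
    [Group.FG G] (h : (⊤ : Subgroup G).lowerCentralSeries c = ⊥) :
    PolyInfiniteCyclicByFinite G := by
  induction c generalizing G with
  | zero =>
    have : Subsingleton G := (Subgroup.subsingleton_iff).mp (subsingleton_of_bot_eq_top h.symm)
    exact .of_finite G
  | succ c ih =>
    set Z := (⊤ : Subgroup G).lowerCentralSeries c
    have hZ : Z ≤ Subgroup.center G := by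
      intro z hz
      refine Subgroup.mem_center_iff.mpr fun g => ?_
      have h1 : ⁅z, g⁆ ∈ (⊤ : Subgroup G).lowerCentralSeries (c + 1) := by
        rw [Subgroup.lowerCentralSeries_succ]
        exact Subgroup.commutator_mem_commutator hz (Subgroup.mem_top g)
      rw [h, Subgroup.mem_bot, commutatorElement_eq_one_iff_mul_comm] at h1
      exact h1.symm
    have hfg : Group.FG Z := by
      obtain ⟨T, hTf, hT, hle⟩ := exists_finite_lowerCentralSeries_le (G := G) c
      rw [h, sup_bot_eq] at hle
      rw [Group.fg_iff_subgroup_fg, Subgroup.fg_iff]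
      exact ⟨T, le_antisymm ((Subgroup.closure_le _).mpr hT) hle, hTf⟩
    have hQ : PolyInfiniteCyclicByFinite (G ⧸ Z) := by
      refine ih ?_
      have := Subgroup.map_lowerCentralSeries (⊤ : Subgroup G) (QuotientGroup.mk' Z) c
      rw [← MonoidHom.range_eq_map, MonoidHom.range_eq_top.mpr (QuotientGroup.mk'_surjective Z)]
        at this
      rw [← this]
      exact (QuotientGroup.map_mk'_self Z)
    exact hQ.of_central_extension (QuotientGroup.mk' Z) (by rwa [QuotientGroup.ker_mk'])
      (by rwa [QuotientGroup.ker_mk'])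

theorem exists_polySeparated (Γ : Type u) [Group Γ] [Group.FG Γ] [Group.IsNilpotent Γ] :
    ∃ n, PolySeparated Γ n := by
  obtain ⟨c, hc⟩ := Subgroup.nilpotent_iff_lowerCentralSeries.mp ‹Group.IsNilpotent Γ›
  exact (polyInfiniteCyclicByFinite_of_lowerCentralSeries c hc).polySeparated inferInstance

/-! ### Coordinates of the congruence kernel -/

section CongruenceKernel

variable {Γ : Type u} [Group Γ] {G : Subgroup (MulAut Γ)}

theorem mem_principalCongruenceSubgroup {M : FiniteIndexNormalSubgroup Γ}
    [M.toSubgroup.Characteristic] {g : G} :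
    g ∈ (principalCongruenceSubgroup G M).toSubgroup ↔
      ∀ x, x⁻¹ * (g : MulAut Γ) x ∈ M.toSubgroup :=
  mem_ker_quotientAut (M := M.toSubgroup) (φ := (g : MulAut Γ))

variable [Group.FG Γ]

/-- The action on the coordinate `charCore M` is read off at its own characteristic core, whence the
iterated `charCore`. -/
theorem mem_principalCongruenceSubgroup_of_coord {a : Completion G} (ha : a ∈ congruenceKernel G)
    {M : FiniteIndexNormalSubgroup Γ} {g : G}
    (hg : coord (principalCongruenceSubgroup G (charCore (charCore M))) a = (g : G ⧸ _)) :
    g ∈ (principalCongruenceSubgroup G (charCore M)).toSubgroup := by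
  refine mem_principalCongruenceSubgroup.mpr fun x => ?_
  have h1 := congrArg (coord (charCore M)) (mem_congruenceKernel.mp ha (eta Γ x))
  rw [coord_act hg rfl, coord_eta] at h1
  exact QuotientGroup.eq.mp h1.symm

theorem mem_congruenceKernel_of_coord {a : Completion G}
    (h : ∀ M : FiniteIndexNormalSubgroup Γ,
      coord (principalCongruenceSubgroup G (charCore M)) a = 1) : a ∈ congruenceKernel G := by
  refine mem_congruenceKernel.mpr fun x => coord_ext fun N => ?_
  obtain ⟨γ, hγ⟩ := QuotientGroup.mk_surjective (coord (charCore N) x)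
  rw [coord_act (g := 1) (h N) hγ.symm, coord_of_le (charCore_le N) hγ.symm]
  rfl

theorem isClosed_congruenceKernel : IsClosed (congruenceKernel G : Set (Completion G)) := by
  have : (congruenceKernel G : Set (Completion G)) = ⋂ x : Completion Γ, {a | act a x = x} := by
    ext a
    rw [SetLike.mem_coe, mem_congruenceKernel, Set.mem_iInter]
    rfl
  rw [this]
  exact isClosed_iInter fun x => isClosed_eq
    (continuous_act.comp (continuous_id.prodMk continuous_const)) continuous_const

end CongruenceKernel

/-! ### Bijectivity of the canonical map -/

section CanonicalMap

variable (Γ : Type u) [Group Γ]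

theorem toAutStar_surjective : Function.Surjective (toAutStar Γ) :=
  (starAut Γ).rangeRestrict_surjective.comp fun φ => ⟨⟨φ, trivial⟩, rfl⟩

variable [Group.FG Γ]

/-- Represent a by g at a level N' inside N. As a dies in the completion of Aut*(Γ), g agrees on Γ*
with some ν in N'. Then ν⁻¹g is trivial on Γ* and on a finite quotient of Γ, so it lies in N by
`exists_congruence_le`. -/
theorem canonicalMap_injective {n : ℕ} (h : PolySeparated Γ n) :
    Function.Injective (canonicalMap Γ) := by
  refine (injective_iff_map_eq_one _).mpr fun a ha => Subtype.ext (coord_ext fun N => ?_)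
  obtain ⟨M, hM⟩ := exists_congruence_le h
    (N.comap (Subgroup.topEquiv.symm : MulAut Γ ≃* _).toMonoidHom).toSubgroup
  let P := principalCongruenceSubgroup (⊤ : Subgroup (MulAut Γ)) (charCore (charCore M))
  let N' := N ⊓ P
  obtain ⟨g, hg⟩ := QuotientGroup.mk_surjective (coord N' a.1)
  have hgM := mem_principalCongruenceSubgroup_of_coord a.2
    (coord_of_le (inf_le_right : N' ≤ P) hg.symm)
  obtain ⟨L, hL⟩ : ∃ L : FiniteIndexNormalSubgroup (AutStar Γ),
      L.toSubgroup = N'.toSubgroup.map (toAutStar Γ) :=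
    ⟨⟨N'.toSubgroup.map (toAutStar Γ),
      Subgroup.Normal.map inferInstance _ (toAutStar_surjective Γ),
      ⟨fun h0 => Subgroup.FiniteIndex.index_ne_zero (H := N'.toSubgroup) (Nat.eq_zero_of_zero_dvd
        (h0 ▸ Subgroup.index_map_dvd _ (toAutStar_surjective Γ)))⟩⟩, rfl⟩
  have hle : N' ≤ L.comap (toAutStar Γ) := by
    change N'.toSubgroup ≤ L.toSubgroup.comap (toAutStar Γ)
    rw [hL]
    exact Subgroup.le_comap_map _ _
  have h1 : coord L (completionMap (toAutStar Γ) a.1) = 1 := by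
    have : completionMap (toAutStar Γ) a.1 = 1 := congrArg Subtype.val ha
    rw [this, map_one]
  rw [coord_completionMap, coord_of_le hle hg.symm] at h1
  obtain ⟨ν, hν, hνg⟩ := hL.le ((QuotientGroup.eq_one_iff _).mp h1)
  have hk : starAut Γ ((ν : MulAut Γ)⁻¹ * g) = 1 := by
    rw [map_mul, map_inv, inv_mul_eq_one]
    exact congrArg Subtype.val hνg
  have hνM : ν ∈ (principalCongruenceSubgroup _ (charCore M)).toSubgroup :=
    principalCongruenceSubgroup_mono _ (charCore_le (charCore M)) hν.2
  have hkN := hM _ hk fun x => charCore_le M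
    (mem_principalCongruenceSubgroup.mp (mul_mem (inv_mem hνM) hgM) x)
  have hgN : g ∈ N.toSubgroup := by
    have := mul_mem hν.1 (show ν⁻¹ * g ∈ N.toSubgroup from hkN)
    rwa [mul_inv_cancel_left] at this
  change coord N a.1 = coord N 1
  rw [map_one, coord_of_le (inf_le_left : N' ≤ N) hg.symm]
  exact (QuotientGroup.eq_one_iff _).mpr hgN

/-- The conditions on a preimage, one for each finite level, cut out a directed family of closed
sets in a compact space; `exists_aut_of_starCongr` shows that each is nonempty. -/
theorem canonicalMap_surjective {n : ℕ} (hn : 2 ≤ n) (h : PolySeparated Γ n) :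
    Function.Surjective (canonicalMap Γ) := by
  rintro ⟨b, hb⟩
  let E : FiniteIndexNormalSubgroup Γ × FiniteIndexNormalSubgroup (AutStar Γ) →
      Set (Completion (⊤ : Subgroup (MulAut Γ))) := fun i =>
    {a | coord (principalCongruenceSubgroup ⊤ (charCore i.1)) a ∈ ({1} : Set _)} ∩
      {a | coord i.2 (completionMap (toAutStar Γ) a) ∈ ({coord i.2 b} : Set _)}
  have hclosed : ∀ {H : Type u} [Group H] (N : FiniteIndexNormalSubgroup H)
      (s : Set (H ⧸ N.toSubgroup)), IsClosed {x : Completion H | coord N x ∈ s} := fun N s =>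
    ⟨isOpen_coord_fiber N sᶜ⟩
  have hE : ∀ i, IsClosed (E i) := fun i => (hclosed _ _).inter
    ((hclosed i.2 _).preimage (completionMap (toAutStar Γ)).continuous_toFun)
  have hne : ∀ i, (E i).Nonempty := by
    rintro ⟨M, N⟩
    obtain ⟨m, hm, H⟩ := exists_aut_of_starCongr hn h (charCore M)
    -- Being congruent to 1 modulo the m-th powers of Γ* is exactly `StarCongr m`.
    let Ms : FiniteIndexNormalSubgroup (Star Γ) :=
      ⟨(powMonoidHom m).range, inferInstance,
        Subgroup.finiteIndex_range_powMonoidHom_of_fg _ hm.ne'⟩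
    let P := principalCongruenceSubgroup (AutStar Γ) (charCore (charCore Ms))
    obtain ⟨g, hg⟩ := QuotientGroup.mk_surjective (coord (N ⊓ P) b)
    have hgM := mem_principalCongruenceSubgroup.mp (mem_principalCongruenceSubgroup_of_coord hb
      (coord_of_le (inf_le_right : N ⊓ P ≤ P) hg.symm))
    obtain ⟨φ, hφ⟩ := g.2
    obtain ⟨ψ, hψ, hψφ⟩ := H φ fun y => by
      obtain ⟨z, hz⟩ := charCore_le Ms (hgM y)
      refine ⟨z, ?_⟩
      rw [hφ]
      exact (eq_inv_mul_iff_mul_eq.mp hz).symm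
    refine ⟨eta _ ⟨ψ, trivial⟩, ?_, ?_⟩
    · exact (QuotientGroup.eq_one_iff _).mpr (mem_principalCongruenceSubgroup.mpr hψ)
    · change coord N (completionMap (toAutStar Γ) (eta _ ⟨ψ, trivial⟩)) = coord N b
      rw [completionMap_eta, coord_eta, coord_of_le (inf_le_left : N ⊓ P ≤ N) hg.symm]
      refine congrArg _ (Subtype.ext ?_)
      exact hψφ.trans hφ
  have hdir : Directed (· ⊇ ·) E := by
    rintro ⟨M, N⟩ ⟨M', N'⟩
    refine ⟨(M ⊓ M', N ⊓ N'), fun a ha => ⟨?_, ?_⟩, fun a ha => ⟨?_, ?_⟩⟩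
    · exact coord_of_le (g := 1) (principalCongruenceSubgroup_mono _ (charCore_mono inf_le_left))
        ha.1
    · obtain ⟨g, hg⟩ := QuotientGroup.mk_surjective (coord (N ⊓ N') b)
      exact (coord_of_le inf_le_left ((show _ = _ from ha.2).trans hg.symm)).trans
        (coord_of_le inf_le_left hg.symm).symm
    · exact coord_of_le (g := 1) (principalCongruenceSubgroup_mono _ (charCore_mono inf_le_right))
        ha.1
    · obtain ⟨g, hg⟩ := QuotientGroup.mk_surjective (coord (N ⊓ N') b)
      exact (coord_of_le inf_le_right ((show _ = _ from ha.2).trans hg.symm)).trans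
        (coord_of_le inf_le_right hg.symm).symm
  let topSubgroup : ∀ (H : Type u) [Group H], FiniteIndexNormalSubgroup H := fun H _ =>
    ⟨⊤, inferInstance, inferInstance⟩
  have : Nonempty (FiniteIndexNormalSubgroup Γ × FiniteIndexNormalSubgroup (AutStar Γ)) :=
    ⟨(topSubgroup Γ, topSubgroup _)⟩
  obtain ⟨a, ha⟩ := IsCompact.nonempty_iInter_of_directed_nonempty_isCompact_isClosed E hdir hne
    (fun i => (hE i).isCompact) hE
  rw [Set.mem_iInter] at ha
  refine ⟨⟨a, mem_congruenceKernel_of_coord fun M => (ha (M, topSubgroup _)).1⟩, Subtype.ext ?_⟩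
  exact coord_ext fun N => (ha (topSubgroup _, N)).2

end CanonicalMap

end CSP

theorem theorem1p1 (Γ : Type u) [Group Γ] [Group.FG Γ] [Group.IsNilpotent Γ] :
    ∃ e : CSP.congruenceKernel (⊤ : Subgroup (MulAut Γ)) ≃ₜ*
        CSP.congruenceKernel (CSP.AutStar Γ),
      ∀ a, e a = CSP.canonicalMap Γ a := by
  obtain ⟨n, hn⟩ := CSP.exists_polySeparated Γ
  -- Degree at least 2 ensures that the homomorphisms Γ → ℤ are among the polynomial functions used.
  have hn' : CSP.PolySeparated Γ (max 2 n) := hn.mono (le_max_right _ _)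
  have : CompactSpace (CSP.congruenceKernel (⊤ : Subgroup (MulAut Γ))) :=
    isCompact_iff_compactSpace.mp CSP.isClosed_congruenceKernel.isCompact
  let e := MulEquiv.ofBijective (CSP.canonicalMap Γ)
    ⟨CSP.canonicalMap_injective Γ hn', CSP.canonicalMap_surjective Γ (le_max_left _ _) hn'⟩
  have he : Continuous e := (CSP.canonicalMap Γ).continuous_toFun
  exact ⟨{ e with
    continuous_toFun := he
    continuous_invFun := he.continuous_symm_of_equiv_compact_to_t2 (f := e.toEquiv) }, fun _ => rfl⟩
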